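/- **Conventions.** A labeled rooted forest is a finite (possibly empty) forest whose vertex set is a finite subset of $\mathbb N$ and in which every component has a distinguished root. An admissible cut $C$ of a rooted tree is a set of edges such that every path from a leaf to the root meets at most one of them, or the *full cut*; the cut gives the rooted forest $P_C$ of the branches cut off and the remaining part $R_C$ containing the root (for the full cut $P_C$ is the whole tree and $R_C=\emptyset$). An admissible cut of a forest $F$ is a choice of an admissible cut of each component, with $P_C(F)$ and $R_C(F)$ the corresponding unions. A subforest $G\subset F$ is a forest $G=P_C(F)$, and then $F/G:=R_C(F)$. $\mathrm{LRF}$ is the category with labeled rooted forests as objects and triples $(C_1,C_2,f)$ as morphisms $F_1\to F_2$, where $C_i$ is an admissible cut of $F_i$ and $f:R_{C_1}(F_1)\cong P_{C_2}(F_2)$ is an isomorphism of rooted forests; triples are composed as partial bijections. $I(\mathrm{LRF})$ is the set of isomorphism classes of its objects, $F\oplus G$ is the disjoint union, and $\delta_F$ is the characteristic function of the class of $F$. Let $\mathcal H_{\mathrm{LRF}}$ be the $\mathbb Q$-vector space of functions $f:I(\mathrm{LRF})\to\mathbb Q$ with finite support, with $$(f\times g)(F)=\sum_{G\subset F} f(G)\,g(F/G),\qquad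 \Delta(f)(F,G)=f(F\oplus G).$$ Let $\mathfrak n_T$ be the $\mathbb Q$-vector space with basis the set of (unlabeled, nonempty) rooted trees, with the bracket $[T_1,T_2]=T_1*T_2-T_2*T_1$, where $T_1*T_2=\sum_T a(T_1,T_2;T)\,T$ and $a(T_1,T_2;T)$ is the number of edges $e$ of $T$ with $P_{\{e\}}(T)\cong T_1$ and $R_{\{e\}}(T)\cong T_2$. **Theorem.** $\mathfrak n_T$ is a Lie algebra. With $\times$ and $\Delta$, $\mathcal H_{\mathrm{LRF}}$ is a cocommutative Hopf algebra over $\mathbb Q$, graded by the number of vertices (product, coproduct, counit and antipode respect the degree) and connected (the degree-$0$ part is $\mathbb Q\cdot 1$). Its space of primitive elements is the span of the functions $\delta_T$ with $T$ a rooted tree. Let $j:\mathfrak n_T\to\mathcal H_{\mathrm{LRF}}$ be the linear map with $j(T)=\delta_T$. Then for all rooted trees $T_1,T_2$ $$\delta_{T_1}\times\delta_{T_2}-\delta_{T_2}\times\delta_{T_1}=j([T_1,T_2]),$$ and $j$ extends to an isomorphism of Hopf algebras $U(\mathfrak n_T)\cong\mathcal H_{\mathrm{LRF}}$, where $U(\mathfrak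 n_T)$ has its standard structure in which the elements of $\mathfrak n_T$ are primitive. -/

import Mathlib

open scoped TensorProduct

/-! ### Labeled rooted forests -/

/-- A labeled rooted forest: a finite vertex set `lab ⊆ ℕ` in which every vertex that is not a root
has a parent. The edges are the pairs `(v, parent v)`; the roots are the `v ∈ lab` with
`parent v = none`, one in each connected component (tree) of the forest. The forest with
`lab = ∅` is the empty forest. -/
@[ext]
structure LabeledForest where
  /-- the labels, identified with the vertices -/
  lab : Finset ℕ
  /-- the vertex one step closer to the root; `none` at roots and off `lab` -/
  parent : ℕ → Option ℕ
  parent_mem : ∀ v w, parent v = some w → v ∈ lab ∧ w ∈ lab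
  acyclic : ∀ v, ¬ Relation.TransGen (fun a b => parent a = some b) v v

namespace LabeledForest

/-- A labeled rooted tree: a forest with exactly one root. -/
def IsTree (F : LabeledForest) : Prop :=
  ∃! r, r ∈ F.lab ∧ F.parent r = none

/-- `F.Below v w`: the path from `v` to its root passes through `w` (and `v = w` is allowed). -/
def Below (F : LabeledForest) : ℕ → ℕ → Prop :=
  Relation.ReflTransGen (fun a b => F.parent a = some b)

/-- Admissible cuts of a forest. A cut is encoded by the set `C` of the lower endpoints of the
edges cut; a root `r ∈ C` stands for the full cut of the tree of `r`. The cut is admissible if a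
path from a leaf to a root meets at most one member of `C`. The empty set is the empty cut. -/
def IsAdmissible (F : LabeledForest) (C : Finset ℕ) : Prop :=
  C ⊆ F.lab ∧ ∀ a ∈ C, ∀ b ∈ C, F.Below a b → a = b

open scoped Classical in
/-- The vertices of `P_C(F)`: those separated from the root by `C`. -/
noncomputable def prunedLab (F : LabeledForest) (C : Finset ℕ) : Finset ℕ :=
  F.lab.filter (fun v => ∃ c ∈ C, F.Below v c)

/-- The vertices of `R_C(F)`: those still connected to a root that has not been cut off. -/
noncomputable def trunkLab (F : LabeledForest) (C : Finset ℕ) : Finset ℕ :=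
  F.lab \ F.prunedLab C

/-- The forest with the vertices of `F` in `S` and the edges of `F` with both ends in `S`. -/
def restrict (F : LabeledForest) (S : Finset ℕ) : LabeledForest where
  lab := F.lab ∩ S
  parent v := if v ∈ S then (F.parent v).filter (fun w => decide (w ∈ S)) else none
  parent_mem v w h := by
    split_ifs at h with hv
    rw [Option.filter_eq_some_iff] at h
    obtain ⟨h1, h2⟩ := h
    have := F.parent_mem v w h1
    simp_all
  acyclic v h := by
    refine F.acyclic v (Relation.TransGen.mono (fun a b hab => ?_) v v h)
    split_ifs at hab with hv
    rw [Option.filter_eq_some_iff] at hab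
    exact hab.1

/-- `P_C(F)`, the forest of the branches cut off by `C`. -/
noncomputable def pruned (F : LabeledForest) (C : Finset ℕ) : LabeledForest :=
  F.restrict (F.prunedLab C)

/-- `R_C(F)`, the part of `F` that contains the roots not cut off by `C`. -/
noncomputable def trunk (F : LabeledForest) (C : Finset ℕ) : LabeledForest :=
  F.restrict (F.trunkLab C)

open scoped Classical in
/-- The subforests `G ⊆ F`, i.e. the forests of the form `P_C(F)` with `C` an admissible cut,
each given by its vertex set. -/
noncomputable def subforests (F : LabeledForest) : Finset (Finset ℕ) :=
  F.lab.powerset.filter (fun S => ∃ C, F.IsAdmissible C ∧ S = F.prunedLab C)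

/-- The quotient `F / G` of `F = P_C(F) ∪ R_C(F)` by the subforest `G = P_C(F)` with vertex set
`S`; it is `R_C(F)`. -/
def quot (F : LabeledForest) (S : Finset ℕ) : LabeledForest :=
  F.restrict (F.lab \ S)

/-- The parent function of a disjoint union: the first forest lives on the even numbers, the second
one on the odd numbers. -/
def sumParent (F G : LabeledForest) (v : ℕ) : Option ℕ :=
  if v % 2 = 0 then (F.parent (v / 2)).map (fun w => 2 * w)
  else (G.parent (v / 2)).map (fun w => 2 * w + 1)

theorem sumParent_trans (F G : LabeledForest) {v w : ℕ}
    (h : Relation.TransGen (fun a b => sumParent F G a = some b) v w) :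
    (v % 2 = 0 ∧ w % 2 = 0 ∧
      Relation.TransGen (fun a b => F.parent a = some b) (v / 2) (w / 2)) ∨
    (v % 2 = 1 ∧ w % 2 = 1 ∧
      Relation.TransGen (fun a b => G.parent a = some b) (v / 2) (w / 2)) := by
  have step : ∀ a b, sumParent F G a = some b →
      (a % 2 = 0 ∧ b % 2 = 0 ∧ F.parent (a / 2) = some (b / 2)) ∨
      (a % 2 = 1 ∧ b % 2 = 1 ∧ G.parent (a / 2) = some (b / 2)) := by
    intro a b hab
    unfold sumParent at hab
    split_ifs at hab with ha
    · obtain ⟨x, hx, rfl⟩ := Option.map_eq_some_iff.1 hab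
      left
      refine ⟨ha, by omega, ?_⟩
      rw [hx]; congr 1; omega
    · obtain ⟨x, hx, rfl⟩ := Option.map_eq_some_iff.1 hab
      right
      refine ⟨by omega, by omega, ?_⟩
      rw [hx]; congr 1; omega
  induction h with
  | single h =>
    rcases step _ _ h with ⟨h1, h2, h3⟩ | ⟨h1, h2, h3⟩
    · exact Or.inl ⟨h1, h2, .single h3⟩
    · exact Or.inr ⟨h1, h2, .single h3⟩
  | tail _ h ih =>
    rcases step _ _ h with ⟨h1, h2, h3⟩ | ⟨h1, h2, h3⟩ <;>
      rcases ih with ⟨h4, h5, h6⟩ | ⟨h4, h5, h6⟩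
    · exact Or.inl ⟨h4, h2, h6.tail h3⟩
    · omega
    · omega
    · exact Or.inr ⟨h4, h2, h6.tail h3⟩

/-- The disjoint union `F ⊕ G`; the labels of `F` are moved to the even numbers and those of `G` to
the odd numbers. -/
def oplus (F G : LabeledForest) : LabeledForest where
  lab := F.lab.image (fun v => 2 * v) ∪ G.lab.image (fun v => 2 * v + 1)
  parent := sumParent F G
  parent_mem v w h := by
    unfold sumParent at h
    split_ifs at h with hv
    · obtain ⟨x, hx, rfl⟩ := Option.map_eq_some_iff.1 h
      have := F.parent_mem _ _ hx
      simp only [Finset.mem_union, Finset.mem_image]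
      exact ⟨Or.inl ⟨_, this.1, by omega⟩, Or.inl ⟨_, this.2, rfl⟩⟩
    · obtain ⟨x, hx, rfl⟩ := Option.map_eq_some_iff.1 h
      have := G.parent_mem _ _ hx
      simp only [Finset.mem_union, Finset.mem_image]
      exact ⟨Or.inr ⟨_, this.1, by omega⟩, Or.inr ⟨_, this.2, rfl⟩⟩
  acyclic v h := by
    rcases sumParent_trans F G h with ⟨_, _, h⟩ | ⟨_, _, h⟩
    · exact F.acyclic _ h
    · exact G.acyclic _ h

/-! ### The category of labeled rooted forests -/

/-- Subforests are exactly the vertex sets closed under passing to children. -/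
theorem exists_prunedLab_iff (F : LabeledForest) (S : Finset ℕ) :
    (∃ C, F.IsAdmissible C ∧ S = F.prunedLab C) ↔
      S ⊆ F.lab ∧ ∀ v w, F.parent v = some w → w ∈ S → v ∈ S := by
  classical
  constructor
  · rintro ⟨C, -, rfl⟩
    refine ⟨Finset.filter_subset _ _, fun v w h hw => ?_⟩
    simp only [prunedLab, Finset.mem_filter] at hw ⊢
    obtain ⟨_, c, hc, hwc⟩ := hw
    exact ⟨(F.parent_mem v w h).1, c, hc, .head h hwc⟩
  · rintro ⟨hS, hcl⟩
    have hdown : ∀ a b, F.Below a b → b ∈ S → a ∈ S := by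
      intro a b h hb
      induction h using Relation.ReflTransGen.head_induction_on with
      | refl => exact hb
      | head h _ ih => exact hcl _ _ h ih
    refine ⟨S.filter (fun v => ∀ w, F.parent v = some w → w ∉ S),
      ⟨(Finset.filter_subset _ _).trans hS, fun a ha b hb hab => ?_⟩, ?_⟩
    · rw [Finset.mem_filter] at ha hb
      rcases Relation.ReflTransGen.cases_head hab with h | ⟨c, hac, hcb⟩
      · exact h
      · exact absurd (hdown _ _ hcb hb.1) (ha.2 _ hac)
    · ext v
      simp only [prunedLab, Finset.mem_filter]
      constructor
      · intro hv
        refine ⟨hS hv, ?_⟩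
        have hwf : WellFounded (fun b a : F.lab =>
            Relation.TransGen (fun a b => F.parent a = some b) (a : ℕ) (b : ℕ)) := by
          have : IsTrans F.lab (fun b a : F.lab =>
            Relation.TransGen (fun a b => F.parent a = some b) (a : ℕ) (b : ℕ)) :=
            ⟨fun _ _ _ h1 h2 => h2.trans h1⟩
          have : Std.Irrefl (fun b a : F.lab =>
            Relation.TransGen (fun a b => F.parent a = some b) (a : ℕ) (b : ℕ)) :=
            ⟨fun a => F.acyclic a⟩
          exact Finite.wellFounded_of_trans_of_irrefl _
        have key : ∀ x : F.lab, (x : ℕ) ∈ S →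
            ∃ c, (c ∈ S ∧ ∀ w, F.parent c = some w → w ∉ S) ∧ F.Below x c := by
          intro x
          induction x using hwf.induction with
          | _ x ih =>
            intro hx
            by_cases h : ∀ w, F.parent x = some w → w ∉ S
            · exact ⟨x, ⟨hx, h⟩, .refl⟩
            · push Not at h
              obtain ⟨w, hw, hwS⟩ := h
              obtain ⟨c, hc, hwc⟩ := ih ⟨w, hS hwS⟩ (.single hw) hwS
              exact ⟨c, hc, .head hw hwc⟩
        exact key ⟨v, hS hv⟩ hv
      · rintro ⟨-, c, ⟨hc, -⟩, hvc⟩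
        exact hdown _ _ hvc hc

/-- A morphism `(C₁, C₂, f) : F₁ → F₂`: admissible cuts `C₁` of `F₁` and `C₂` of `F₂` together with
an isomorphism `f : R_{C₁}(F₁) ≅ P_{C₂}(F₂)`, i.e. a bijection of the vertices that preserves the
edges and their orientation towards the root (and so preserves the roots). It is encoded by the
partial bijection `f` between the labels of `F₁` and `F₂`, which determines the two cuts. -/
@[ext]
structure Hom (F G : LabeledForest) where
  map : ℕ ≃. ℕ
  source_cut : ∃ C, F.IsAdmissible C ∧ ∀ v, (map v).isSome ↔ v ∈ F.trunkLab C
  target_cut : ∃ C, G.IsAdmissible C ∧ ∀ w, (map.symm w).isSome ↔ w ∈ G.prunedLab C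
  edge : ∀ v w v' w', map v = some v' → map w = some w' →
    (F.parent v = some w ↔ G.parent v' = some w')

theorem exists_trunkLab_iff (F : LabeledForest) (p : ℕ → Prop) :
    (∃ C, F.IsAdmissible C ∧ ∀ v, p v ↔ v ∈ F.trunkLab C) ↔
      (∀ v, p v → v ∈ F.lab) ∧ ∀ v w, F.parent v = some w → p v → p w := by
  classical
  constructor
  · rintro ⟨C, hC, h⟩
    have := ((exists_prunedLab_iff F _).1 ⟨C, hC, rfl⟩)
    refine ⟨fun v hv => ?_, fun v w hvw hv => ?_⟩
    · exact (Finset.mem_sdiff.1 ((h v).1 hv)).1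
    · rw [h, trunkLab, Finset.mem_sdiff] at hv ⊢
      exact ⟨(F.parent_mem v w hvw).2, fun hw => hv.2 (this.2 v w hvw hw)⟩
  · rintro ⟨h1, h2⟩
    obtain ⟨C, hC, h⟩ := (exists_prunedLab_iff F (F.lab.filter (fun v => ¬ p v))).2
      ⟨Finset.filter_subset _ _, fun v w hvw hw => by
        rw [Finset.mem_filter] at hw ⊢
        exact ⟨(F.parent_mem v w hvw).1, fun hv => hw.2 (h2 v w hvw hv)⟩⟩
    refine ⟨C, hC, fun v => ?_⟩
    rw [trunkLab, ← h]
    simp only [Finset.mem_sdiff, Finset.mem_filter]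
    have := h1 v
    tauto

theorem exists_prunedLab_iff' (F : LabeledForest) (p : ℕ → Prop) :
    (∃ C, F.IsAdmissible C ∧ ∀ v, p v ↔ v ∈ F.prunedLab C) ↔
      (∀ v, p v → v ∈ F.lab) ∧ ∀ v w, F.parent v = some w → p w → p v := by
  classical
  constructor
  · rintro ⟨C, hC, h⟩
    have := ((exists_prunedLab_iff F _).1 ⟨C, hC, rfl⟩)
    simp only [h]
    exact ⟨fun v hv => this.1 hv, this.2⟩
  · rintro ⟨h1, h2⟩
    obtain ⟨C, hC, h⟩ := (exists_prunedLab_iff F (F.lab.filter (fun v => p v))).2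
      ⟨Finset.filter_subset _ _, fun v w hvw hw => by
        rw [Finset.mem_filter] at hw ⊢
        exact ⟨(F.parent_mem v w hvw).1, (h2 v w hvw hw.2)⟩⟩
    refine ⟨C, hC, fun v => ?_⟩
    rw [← h]
    simp only [Finset.mem_filter]
    have := h1 v
    tauto

/-- The identity `(C_null, C_full, id)`. -/
noncomputable def Hom.id (F : LabeledForest) : Hom F F where
  map := PEquiv.ofSet (F.lab : Set ℕ)
  source_cut := by
    rw [exists_trunkLab_iff]
    simp only [Option.isSome_iff_exists, PEquiv.ofSet_eq_some_iff]
    simp only [Finset.mem_coe]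
    exact ⟨by rintro v ⟨_, rfl, h⟩; exact h,
      fun v w h _ => ⟨w, rfl, (F.parent_mem v w h).2⟩⟩
  target_cut := by
    rw [exists_prunedLab_iff', PEquiv.ofSet_symm]
    simp only [Option.isSome_iff_exists, PEquiv.ofSet_eq_some_iff]
    simp only [Finset.mem_coe]
    exact ⟨by rintro v ⟨_, rfl, h⟩; exact h,
      fun v w h _ => ⟨v, rfl, (F.parent_mem v w h).1⟩⟩
  edge v w v' w' h h' := by
    simp only [PEquiv.ofSet_eq_some_iff] at h h'
    rw [h.1, h'.1]

/-- The composition of morphisms: composition of the partial bijections, on the largest domain on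
which it makes sense. -/
def Hom.comp {F G H : LabeledForest} (f : Hom F G) (g : Hom G H) : Hom F H where
  map := f.map.trans g.map
  source_cut := by
    have hf := (exists_trunkLab_iff _ _).1 f.source_cut
    have hg := (exists_trunkLab_iff _ _).1 g.source_cut
    rw [exists_trunkLab_iff]
    simp only [Option.isSome_iff_exists, PEquiv.trans_eq_some] at hf hg ⊢
    refine ⟨fun v ⟨x, y, hy, _⟩ => hf.1 v ⟨y, hy⟩, fun v w hvw ⟨x, y, hy, hx⟩ => ?_⟩
    obtain ⟨z, hz⟩ := hf.2 v w hvw ⟨y, hy⟩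
    obtain ⟨u, hu⟩ := hg.2 y z ((f.edge v w y z hy hz).1 hvw) ⟨x, hx⟩
    exact ⟨u, z, hz, hu⟩
  target_cut := by
    have hf := (exists_prunedLab_iff' _ _).1 f.target_cut
    have hg := (exists_prunedLab_iff' _ _).1 g.target_cut
    rw [exists_prunedLab_iff']
    simp only [Option.isSome_iff_exists, PEquiv.eq_some_iff, PEquiv.trans_eq_some] at hf hg ⊢
    refine ⟨fun v ⟨x, y, _, hy⟩ => hg.1 v ⟨y, hy⟩, fun v w hvw ⟨x, y, hy, hx⟩ => ?_⟩
    obtain ⟨z, hz⟩ := hg.2 v w hvw ⟨y, hx⟩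
    obtain ⟨u, hu⟩ := hf.2 z y ((g.edge z y v w hz hx).2 hvw) ⟨x, hy⟩
    exact ⟨u, z, hu, hz⟩
  edge v w v' w' h h' := by
    rw [PEquiv.trans_eq_some] at h h'
    obtain ⟨x, hx, hx'⟩ := h
    obtain ⟨y, hy, hy'⟩ := h'
    exact (f.edge _ _ _ _ hx hy).trans (g.edge _ _ _ _ hx' hy')

theorem Hom.mem_source {F G : LabeledForest} (f : Hom F G) {v w : ℕ} (h : f.map v = some w) :
    v ∈ F.lab :=
  ((exists_trunkLab_iff _ _).1 f.source_cut).1 v (by rw [h]; rfl)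

theorem Hom.mem_target {F G : LabeledForest} (f : Hom F G) {v w : ℕ} (h : f.map v = some w) :
    w ∈ G.lab :=
  ((exists_prunedLab_iff' _ _).1 f.target_cut).1 w (by rw [(f.map.eq_some_iff).2 h]; rfl)

/-- The category of labeled rooted forests. -/
noncomputable instance category : CategoryTheory.Category LabeledForest where
  Hom := Hom
  id := Hom.id
  comp := Hom.comp
  id_comp {F G} f := by
    apply Hom.ext
    apply PEquiv.ext
    intro v
    ext w
    simp only [Hom.comp, Hom.id, PEquiv.trans_eq_some, PEquiv.ofSet_eq_some_iff, Finset.mem_coe]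
    constructor
    · rintro ⟨_, ⟨rfl, _⟩, h⟩; exact h
    · intro h; exact ⟨v, ⟨rfl, f.mem_source h⟩, h⟩
  comp_id {F G} f := by
    apply Hom.ext
    apply PEquiv.ext
    intro v
    ext w
    simp only [Hom.comp, Hom.id, PEquiv.trans_eq_some, PEquiv.ofSet_eq_some_iff, Finset.mem_coe]
    constructor
    · rintro ⟨_, h, rfl, _⟩; exact h
    · intro h; exact ⟨w, h, rfl, f.mem_target h⟩
  assoc f g h := Hom.ext (PEquiv.trans_assoc _ _ _)

/-- The isomorphism `(C_null, C_full, σ)` given by an isomorphism of forests. -/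
def Hom.ofEquiv {F G : LabeledForest} (σ : F.lab ≃ G.lab) (hσ : ∀ v w : F.lab,
    F.parent v = some (w : ℕ) ↔ G.parent (σ v) = some (σ w : ℕ)) : Hom F G where
  map :=
    { toFun := fun v => if h : v ∈ F.lab then some (σ ⟨v, h⟩ : ℕ) else none
      invFun := fun w => if h : w ∈ G.lab then some (σ.symm ⟨w, h⟩ : ℕ) else none
      inv := by
        intro v w
        simp only [Option.dite_none_right_eq_some, Option.some.injEq]
        constructor
        · rintro ⟨h, rfl⟩; exact ⟨(σ.symm ⟨w, h⟩).2, by simp⟩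
        · rintro ⟨h, rfl⟩; exact ⟨(σ ⟨v, h⟩).2, by simp⟩ }
  source_cut := by
    rw [exists_trunkLab_iff]
    simp only [PEquiv.coe_mk, Option.isSome_dite]
    exact ⟨fun v h => h, fun v w h _ => (F.parent_mem v w h).2⟩
  target_cut := by
    rw [exists_prunedLab_iff']
    simp only [PEquiv.symm, PEquiv.coe_mk, Option.isSome_dite]
    exact ⟨fun v h => h, fun v w h _ => (G.parent_mem v w h).1⟩
  edge v w v' w' h h' := by
    simp only [PEquiv.coe_mk, Option.dite_none_right_eq_some, Option.some.injEq] at h h'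
    obtain ⟨h, rfl⟩ := h
    obtain ⟨h', rfl⟩ := h'
    exact hσ ⟨v, h⟩ ⟨w, h'⟩

theorem Hom.ofEquiv_comp {F G : LabeledForest} (σ : F.lab ≃ G.lab) (hσ) (hσ') :
    (Hom.ofEquiv σ hσ).comp (Hom.ofEquiv σ.symm hσ') = Hom.id F := by
  apply Hom.ext
  apply PEquiv.ext
  intro v
  ext w
  simp only [Hom.comp, Hom.id, Hom.ofEquiv, PEquiv.trans_eq_some, PEquiv.ofSet_eq_some_iff,
    PEquiv.coe_mk, Option.dite_none_right_eq_some, Option.some.injEq, Finset.mem_coe]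
  constructor
  · rintro ⟨_, ⟨h, rfl⟩, h', rfl⟩
    simp [h]
  · rintro ⟨rfl, h⟩
    exact ⟨_, ⟨h, rfl⟩, (σ ⟨_, h⟩).2, by simp⟩

/-- Two forests are isomorphic in the category iff there is a bijection of their labels that
preserves the edges and their orientation. -/
theorem nonempty_iso_iff (F G : LabeledForest) :
    Nonempty (CategoryTheory.Iso F G) ↔
      ∃ σ : F.lab ≃ G.lab, ∀ v w : F.lab,
        F.parent v = some (w : ℕ) ↔ G.parent (σ v) = some (σ w : ℕ) := by
  constructor
  · rintro ⟨i⟩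
    have h1 : ∀ v, ∀ h : v ∈ F.lab, ∃ w : G.lab, i.hom.map v = some (w : ℕ) := by
      intro v h
      have := congrArg (fun f : Hom F F => f.map v) i.hom_inv_id
      have h2 : (i.hom.map.trans i.inv.map) v = some v := by
        refine Eq.trans this ?_
        exact PEquiv.ofSet_eq_some_iff.2 ⟨rfl, h⟩
      rw [PEquiv.trans_eq_some] at h2
      obtain ⟨w, hw, _⟩ := h2
      exact ⟨⟨w, Hom.mem_target i.hom hw⟩, hw⟩
    have h2 : ∀ w, ∀ h : w ∈ G.lab, ∃ v : F.lab, i.hom.map v = some w := by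
      intro w h
      have := congrArg (fun f : Hom G G => f.map w) i.inv_hom_id
      have h2 : (i.inv.map.trans i.hom.map) w = some w := by
        refine Eq.trans this ?_
        exact PEquiv.ofSet_eq_some_iff.2 ⟨rfl, h⟩
      rw [PEquiv.trans_eq_some] at h2
      obtain ⟨v, _, hv⟩ := h2
      exact ⟨⟨v, Hom.mem_source i.hom hv⟩, hv⟩
    choose σ hσ using fun v : F.lab => h1 v v.2
    refine ⟨Equiv.ofBijective σ ⟨fun v w h => ?_, fun w => ?_⟩, fun v w => ?_⟩
    · have hv := hσ v
      rw [h] at hv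
      exact Subtype.ext (i.hom.map.inj hv (hσ w))
    · obtain ⟨v, hv⟩ := h2 w w.2
      exact ⟨v, Subtype.ext (Option.some.inj ((hσ v).symm.trans hv))⟩
    · exact i.hom.edge _ _ _ _ (hσ v) (hσ w)
  · rintro ⟨σ, hσ⟩
    have hσ' : ∀ v w : G.lab,
        G.parent v = some (w : ℕ) ↔ F.parent (σ.symm v) = some (σ.symm w : ℕ) := by
      intro v w
      rw [hσ]
      simp
    exact ⟨⟨Hom.ofEquiv σ hσ, Hom.ofEquiv σ.symm hσ', Hom.ofEquiv_comp σ _ _,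
      Hom.ofEquiv_comp σ.symm _ _⟩⟩

/-- The isomorphism classes of objects. -/
abbrev IsoClass : Type := Quotient (CategoryTheory.isIsomorphicSetoid LabeledForest)

/-- The isomorphism class `[F]`. -/
noncomputable def cls (F : LabeledForest) : IsoClass := Quotient.mk _ F

end LabeledForest

/-- Unlabeled rooted trees: isomorphism classes of labeled rooted trees. -/
def UnlabeledTree : Type :=
  {x : LabeledForest.IsoClass // ∃ T : LabeledForest, T.IsTree ∧ T.cls = x}

open scoped Classical in
/-- For a labeled tree `T`, the number `a(T₁, T₂; T)` of edges `e` of `T` such that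
`P_{C_e}(T) ≅ T₁` and `R_{C_e}(T) ≅ T₂`, where `C_e` is the cut at `e`; edges are given by their
lower endpoint, a vertex that has a parent. -/
noncomputable def LabeledForest.graftCount (t₁ t₂ : UnlabeledTree) (T : LabeledForest) : ℕ :=
  (T.lab.filter (fun v => (T.parent v).isSome ∧
    (T.pruned {v}).cls = t₁.1 ∧ (T.trunk {v}).cls = t₂.1)).card

/-! ### The Connes–Kreimer Lie algebra on rooted trees -/

/-- The set underlying `𝔫_T`: formal finite rational combinations of rooted trees. -/
def TreeLie : Type := UnlabeledTree →₀ ℚ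

namespace TreeLie

/-- The coefficient of a tree. -/
def coeff (x : TreeLie) (t : UnlabeledTree) : ℚ := Finsupp.toFun x t

/-- The basis element given by a tree. -/
noncomputable def ofTree (t : UnlabeledTree) : TreeLie := Finsupp.single t (1 : ℚ)

/-- A Lie algebra structure is the one of Connes and Kreimer if the linear structure is the
coefficientwise one and the bracket of trees is `[t₁, t₂] = t₁ * t₂ - t₂ * t₁` with
`t₁ * t₂ = ∑_T a(t₁, t₂; T) T`. There is at most one such structure. -/
structure IsConnesKreimer [LieRing TreeLie] [LieAlgebra ℚ TreeLie] : Prop where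
  coeff_add : ∀ (x y : TreeLie) (t : UnlabeledTree), (x + y).coeff t = x.coeff t + y.coeff t
  coeff_smul : ∀ (c : ℚ) (x : TreeLie) (t : UnlabeledTree), (c • x).coeff t = c * x.coeff t
  coeff_bracket : ∀ (t₁ t₂ : UnlabeledTree) (T : LabeledForest) (hT : T.IsTree),
    ⁅ofTree t₁, ofTree t₂⁆.coeff ⟨T.cls, T, hT, rfl⟩ =
      (T.graftCount t₁ t₂ : ℚ) - (T.graftCount t₂ t₁ : ℚ)

end TreeLie

/-! ### The Ringel–Hall algebra -/

/-- The set underlying the Ringel–Hall algebra: the finitely supported rational functions on the set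
of isomorphism classes of labeled rooted forests. -/
def Hall : Type := LabeledForest.IsoClass →₀ ℚ

namespace Hall

/-- The value of a function at the isomorphism class of `F`. -/
noncomputable def val (f : Hall) (F : LabeledForest) : ℚ := Finsupp.toFun f F.cls

/-- The characteristic function of an isomorphism class. -/
noncomputable def delta (x : LabeledForest.IsoClass) : Hall := Finsupp.single x (1 : ℚ)

/-- The map `j` from combinations of trees to functions, `∑ c_t t ↦ ∑ c_t δ_t`. -/
noncomputable def ofTrees (x : TreeLie) : Hall :=
  Finsupp.mapDomain (fun t : UnlabeledTree => t.1) (show UnlabeledTree →₀ ℚ from x)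

/-- A Hopf algebra structure is the Ringel–Hall structure if the linear structure is pointwise
(evaluations are linear), the product is the convolution product
`(f × g)(F) = ∑_{G ⊆ F} f(G) g(F / G)` and the coproduct is `Δ(f)(F, G) = f(F ⊕ G)`, where a tensor
`a ⊗ b` is the function `(F, G) ↦ a(F) b(G)`. There is at most one such structure. -/
structure IsRingelHall [Ring Hall] [HopfAlgebra ℚ Hall] : Prop where
  val_mul : ∀ (f g : Hall) (F : LabeledForest),
    (f * g).val F = ∑ S ∈ F.subforests, f.val (F.restrict S) * g.val (F.quot S)
  val_comul : ∃ ev : LabeledForest → Hall →ₗ[ℚ] ℚ, (∀ F f, ev F f = f.val F) ∧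
    ∀ (f : Hall) (F G : LabeledForest),
      LinearMap.mul' ℚ ℚ (TensorProduct.map (ev F) (ev G) (Coalgebra.comul (R := ℚ) f)) =
        f.val (F.oplus G)

/-- The functions of degree `n`: the span of the characteristic functions of the forests with `n`
vertices. -/
def degree [Ring Hall] [HopfAlgebra ℚ Hall] (n : ℕ) : Submodule ℚ Hall :=
  Submodule.span ℚ {f | ∃ F : LabeledForest, F.lab.card = n ∧ f = delta F.cls}

/-- The number of vertices makes the Hopf algebra graded and connected. -/
structure IsGradedConnected [Ring Hall] [HopfAlgebra ℚ Hall] : Prop where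
  graded : Nonempty (GradedAlgebra degree)
  comul_mem : ∀ n, ∀ f ∈ degree n, Coalgebra.comul (R := ℚ) f ∈
    ⨆ p ∈ Finset.HasAntidiagonal.antidiagonal n,
      LinearMap.range (TensorProduct.map (degree p.1).subtype (degree p.2).subtype)
  counit_eq_zero : ∀ n, n ≠ 0 → ∀ f ∈ degree n, Coalgebra.counit (R := ℚ) f = 0
  antipode_mem : ∀ n, ∀ f ∈ degree n, HopfAlgebra.antipode ℚ f ∈ degree n
  connected : degree 0 = Submodule.span ℚ {(1 : Hall)}

end Hall

/-! ### The universal enveloping algebra as a bialgebra -/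

namespace UniversalEnvelopingAlgebra

section

attribute [local instance] LieRing.ofAssociativeRing

variable (R : Type*) (L : Type*) [CommRing R] [LieRing L] [LieAlgebra R L]

/-- The Lie algebra map `x ↦ x ⊗ 1 + 1 ⊗ x`. -/
noncomputable def primitiveHom :
    L →ₗ⁅R⁆ UniversalEnvelopingAlgebra R L ⊗[R] UniversalEnvelopingAlgebra R L where
  toLinearMap := (TensorProduct.mk R _ _).flip 1 ∘ₗ (ι R : L →ₗ⁅R⁆ _).toLinearMap +
    TensorProduct.mk R _ _ 1 ∘ₗ (ι R : L →ₗ⁅R⁆ _).toLinearMap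
  map_lie' {x y} := by
    simp [LieRing.of_associative_ring_bracket, mul_add, add_mul,
      TensorProduct.tmul_sub, -ι_apply]
    abel

theorem primitiveHom_apply (x : L) :
    primitiveHom R L x = ι R x ⊗ₜ[R] 1 + 1 ⊗ₜ[R] ι R x := rfl

variable {R L} in
theorem algHom_ext {A : Type*} [Ring A] [Algebra R A]
    {g₁ g₂ : UniversalEnvelopingAlgebra R L →ₐ[R] A} (h : ∀ x, g₁ (ι R x) = g₂ (ι R x)) :
    g₁ = g₂ :=
  hom_ext R (LieHom.ext h)

/-- The standard bialgebra structure, for which the elements of `L` are primitive. -/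
noncomputable instance instBialgebra : Bialgebra R (UniversalEnvelopingAlgebra R L) :=
  .ofAlgHom (lift R (primitiveHom R L)) (lift R (0 : L →ₗ⁅R⁆ R))
    (by
      refine algHom_ext fun x => ?_
      simp [primitiveHom_apply, lift_ι_apply, Algebra.TensorProduct.one_def,
        TensorProduct.add_tmul, TensorProduct.tmul_add, -ι_apply]
      abel)
    (by
      refine algHom_ext fun x => ?_
      simp [primitiveHom_apply, lift_ι_apply, -ι_apply])
    (by
      refine algHom_ext fun x => ?_
      simp [primitiveHom_apply, lift_ι_apply, -ι_apply])

end

end UniversalEnvelopingAlgebra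

/-! ### Relabelling forests -/

namespace LabeledForest

/-! Bialgebra. A subforest is a set of vertices closed under passing to children (`mem_subforests`),
and under disjoint union the isomorphism classes form the free commutative monoid on the trees
(`comps_sum`, `sum_comps`). Associativity holds because both bracketings of a triple product are
sums over chains of two subforests (`sum_chains`). The coproduct is dual to the disjoint union, so
its laws are the laws of a commutative monoid. It is multiplicative because a subforest of F ⊕ G is
a pair of subforests (`sum_subforests_oplus`). Finite supports are preserved since there are
finitely many classes of each size (`finite_size_le`).

Primitive elements. Primitivity of f means f(∅) = 0 and f(F ⊕ G) = 0 for nonempty F and G, that is,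
f is supported on trees (`isPrim_iff`). Commutators of primitives are primitive, so the bracket of
𝔫_T can be pulled back from the Hall algebra: the Lie identities come for free, and only the
structure constants need combinatorics (`ev_basis_mul_basis`).

The isomorphism. Let `ordered` send δ_F to the product in U(𝔫_T) of the components of F, in some
chosen order. It is surjective, because interchanging two neighbouring letters costs only a shorter
word; this is the easy half of Poincaré–Birkhoff–Witt. The composite Hall → U(𝔫_T) → Hall sends δ_F
to the Hall product of its components. That product has a positive coefficient at F, and otherwise
is supported on forests with fewer components than F (`eq_sum_of_ev_prod_ne_zero`). So the composite
is triangular for the number of components, hence bijective, and with the surjectivity of `ordered`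
this makes U(𝔫_T) → Hall bijective (`envHom_bijective`).

Antipode. It is transported from U(𝔫_T), as the anti-homomorphism that is x ↦ -x on primitives. It
preserves the degree because it commutes with the automorphism that scales degree n by 2^n. -/

theorem ext_rel {F G : LabeledForest} (h₁ : F.lab = G.lab)
    (h₂ : ∀ v w, F.parent v = some w ↔ G.parent v = some w) : F = G :=
  LabeledForest.ext h₁ (funext fun v => Option.ext fun w => h₂ v w)

theorem restrict_parent_iff (F : LabeledForest) (S : Finset ℕ) (v w : ℕ) :
    (F.restrict S).parent v = some w ↔ v ∈ S ∧ w ∈ S ∧ F.parent v = some w := by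
  simp only [restrict]
  split_ifs with h
  · rw [Option.filter_eq_some_iff]; simp [h, and_comm]
  · simp [h]

theorem restrict_parent_eq_none_iff (F : LabeledForest) (S : Finset ℕ) (v : ℕ) :
    (F.restrict S).parent v = none ↔ (v ∈ S → ∀ w, F.parent v = some w → w ∉ S) := by
  rw [Option.eq_none_iff_forall_ne_some]
  simp only [ne_eq, restrict_parent_iff]
  grind

@[simp] theorem restrict_lab (F : LabeledForest) (S : Finset ℕ) :
    (F.restrict S).lab = F.lab ∩ S := rfl

theorem restrict_restrict (F : LabeledForest) (S T : Finset ℕ) :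
    (F.restrict S).restrict T = F.restrict (S ∩ T) := by
  refine ext_rel (by simp [Finset.inter_assoc]) fun v w => ?_
  simp only [restrict_parent_iff, Finset.mem_inter]
  tauto

theorem restrict_eq_of_inter_eq (F : LabeledForest) {S T : Finset ℕ}
    (h : F.lab ∩ S = F.lab ∩ T) : F.restrict S = F.restrict T := by
  refine ext_rel h fun v w => ?_
  simp only [restrict_parent_iff]
  have h' : ∀ x ∈ F.lab, (x ∈ S ↔ x ∈ T) := fun x hx => by
    simpa [hx] using congrArg (x ∈ ·) h
  constructor <;> rintro ⟨h1, h2, h3⟩ <;> have := F.parent_mem v w h3 <;>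
    simp_all

theorem restrict_self (F : LabeledForest) : F.restrict F.lab = F := by
  refine ext_rel (by simp) fun v w => ?_
  rw [restrict_parent_iff]
  exact ⟨fun h => h.2.2, fun h => ⟨(F.parent_mem v w h).1, (F.parent_mem v w h).2, h⟩⟩

/-- Replaces the existence of a cut by a closure condition. The bijections between sets of
subforests below are all checked through this form. -/
theorem mem_subforests {F : LabeledForest} {S : Finset ℕ} :
    S ∈ F.subforests ↔ S ⊆ F.lab ∧ ∀ v w, F.parent v = some w → w ∈ S → v ∈ S := by
  classical
  rw [subforests, Finset.mem_filter, exists_prunedLab_iff, Finset.mem_powerset]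
  tauto

/-- Relabelling a forest along an embedding of the set of labels. -/
noncomputable def relabel (F : LabeledForest) (e : ℕ ↪ ℕ) : LabeledForest where
  lab := F.lab.map e
  parent w := (Function.partialInv e w).bind fun v => (F.parent v).map e
  parent_mem v w h := by
    rw [Option.bind_eq_some_iff] at h
    obtain ⟨a, ha, h⟩ := h
    obtain ⟨b, hb, rfl⟩ := Option.map_eq_some_iff.1 h
    rw [e.injective.isPartialInv a v] at ha
    subst ha
    have := F.parent_mem a b hb
    simpa using this
  acyclic v h := by
    have key : ∀ x y, Relation.TransGen (fun x y =>
        ((Function.partialInv e x).bind fun v => (F.parent v).map e) = some y) x y →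
        ∃ a b, e a = x ∧ e b = y ∧ Relation.TransGen (fun a b => F.parent a = some b) a b := by
      have step : ∀ x y, ((Function.partialInv e x).bind fun v => (F.parent v).map e) = some y →
          ∃ a b, e a = x ∧ e b = y ∧ F.parent a = some b := by
        intro x y h
        rw [Option.bind_eq_some_iff] at h
        obtain ⟨a, ha, h⟩ := h
        obtain ⟨b, hb, rfl⟩ := Option.map_eq_some_iff.1 h
        exact ⟨a, b, (e.injective.isPartialInv a x).1 ha, rfl, hb⟩
      intro x y h
      induction h with
      | single h =>
        obtain ⟨a, b, ha, hb, h⟩ := step _ _ h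
        exact ⟨a, b, ha, hb, .single h⟩
      | tail _ h ih =>
        obtain ⟨a, b, ha, hb, h⟩ := step _ _ h
        obtain ⟨c, d, hc, hd, h'⟩ := ih
        have : a = d := e.injective (ha.trans hd.symm)
        subst this
        exact ⟨c, b, hc, hb, h'.tail h⟩
    obtain ⟨a, b, ha, hb, h⟩ := key v v h
    have : a = b := e.injective (ha.trans hb.symm)
    subst this
    exact F.acyclic a h

@[simp] theorem relabel_lab (F : LabeledForest) (e : ℕ ↪ ℕ) :
    (F.relabel e).lab = F.lab.map e := rfl

theorem relabel_parent_iff (F : LabeledForest) (e : ℕ ↪ ℕ) (x y : ℕ) :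
    (F.relabel e).parent x = some y ↔ ∃ a b, e a = x ∧ e b = y ∧ F.parent a = some b := by
  simp only [relabel, Option.bind_eq_some_iff, Option.map_eq_some_iff,
    e.injective.isPartialInv _ x]
  constructor
  · rintro ⟨a, ha, b, hb, rfl⟩; exact ⟨a, b, ha, rfl, hb⟩
  · rintro ⟨a, b, ha, rfl, hb⟩; exact ⟨a, ha, b, hb, rfl⟩

theorem relabel_parent_apply_iff (F : LabeledForest) (e : ℕ ↪ ℕ) (a b : ℕ) :
    (F.relabel e).parent (e a) = some (e b) ↔ F.parent a = some b := by
  rw [relabel_parent_iff]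
  simp

theorem relabel_parent_eq_none_iff (F : LabeledForest) (e : ℕ ↪ ℕ) (a : ℕ) :
    (F.relabel e).parent (e a) = none ↔ F.parent a = none := by
  rw [Option.eq_none_iff_forall_ne_some, Option.eq_none_iff_forall_ne_some]
  simp only [ne_eq, relabel_parent_iff]
  refine ⟨fun h b hb => h (e b) ⟨a, b, rfl, rfl, hb⟩, ?_⟩
  rintro h _ ⟨a', b, ha, -, hb⟩
  exact h b (e.injective ha ▸ hb)

theorem cls_eq_iff_nonempty_iso {F G : LabeledForest} :
    F.cls = G.cls ↔ Nonempty (CategoryTheory.Iso F G) :=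
  Quotient.eq (r := CategoryTheory.isIsomorphicSetoid LabeledForest)

theorem cls_relabel (F : LabeledForest) (e : ℕ ↪ ℕ) : (F.relabel e).cls = F.cls := by
  symm
  rw [cls_eq_iff_nonempty_iso, nonempty_iso_iff]
  refine ⟨Equiv.ofBijective (fun v => ⟨e v, Finset.mem_map_of_mem e v.2⟩)
    ⟨fun v w h => ?_, fun w => ?_⟩, fun v w => (relabel_parent_apply_iff F e v w).symm⟩
  · exact Subtype.ext (e.injective (congrArg Subtype.val h))
  · obtain ⟨v, hv, h⟩ := Finset.mem_map.1 w.2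
    exact ⟨⟨v, hv⟩, Subtype.ext h⟩

/-- The complements of two finite label sets are both countably infinite, so an isomorphism extends
to a permutation of ℕ. Invariance under isomorphism thus reduces to invariance under a global
relabelling, which can be substituted for the second forest. -/
theorem cls_eq_iff {F G : LabeledForest} :
    F.cls = G.cls ↔ ∃ τ : ℕ ↪ ℕ, G = F.relabel τ := by
  refine ⟨fun h => ?_, ?_⟩
  · rw [cls_eq_iff_nonempty_iso, nonempty_iso_iff] at h
    obtain ⟨σ, hσ⟩ := h
    have hinf : ∀ s : Finset ℕ, Infinite {x // ¬ x ∈ s} := fun s =>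
      (s.finite_toSet.infinite_compl).to_subtype
    have := hinf F.lab
    have := hinf G.lab
    obtain ⟨ρ⟩ := nonempty_equiv_of_countable (α := {x // ¬ x ∈ F.lab}) (β := {x // ¬ x ∈ G.lab})
    set τ : Equiv.Perm ℕ := Equiv.subtypeCongr σ ρ with hτ
    have hτ' : ∀ v : F.lab, τ v = σ v := by
      intro v
      rw [hτ]
      simp [Equiv.subtypeCongr]
    have hlab : G.lab = F.lab.map τ.toEmbedding := by
      ext w
      simp only [Finset.mem_map, Equiv.coe_toEmbedding]
      constructor
      · intro hw
        exact ⟨σ.symm ⟨w, hw⟩, (σ.symm ⟨w, hw⟩).2, by rw [hτ']; simp⟩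
      · rintro ⟨v, hv, rfl⟩
        rw [hτ' ⟨v, hv⟩]
        exact (σ ⟨v, hv⟩).2
    refine ⟨τ.toEmbedding, ext_rel hlab fun x y => ?_⟩
    rw [relabel_parent_iff]
    constructor
    · intro h
      have hm := G.parent_mem x y h
      rw [hlab, Finset.mem_map, Finset.mem_map] at hm
      obtain ⟨⟨a, ha, rfl⟩, b, hb, rfl⟩ := hm
      refine ⟨a, b, rfl, rfl, ?_⟩
      have := hσ ⟨a, ha⟩ ⟨b, hb⟩
      rw [← hτ', ← hτ'] at this
      exact this.2 h
    · rintro ⟨a, b, rfl, rfl, h⟩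
      have hm := F.parent_mem a b h
      have := (hσ ⟨a, hm.1⟩ ⟨b, hm.2⟩).1 h
      rwa [← hτ', ← hτ'] at this
  · rintro ⟨τ, rfl⟩
    exact (cls_relabel F τ).symm

theorem relabel_restrict (F : LabeledForest) (e : ℕ ↪ ℕ) (S : Finset ℕ) :
    (F.relabel e).restrict (S.map e) = (F.restrict S).relabel e := by
  refine ext_rel (by simp [Finset.map_inter]) fun x y => ?_
  simp only [restrict_parent_iff, relabel_parent_iff]
  constructor
  · rintro ⟨h1, h2, a, b, rfl, rfl, h⟩
    exact ⟨a, b, rfl, rfl, by simpa using h1, by simpa using h2, h⟩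
  · rintro ⟨a, b, rfl, rfl, h1, h2, h⟩
    exact ⟨by simpa using h1, by simpa using h2, a, b, rfl, rfl, h⟩

theorem relabel_quot (F : LabeledForest) (e : ℕ ↪ ℕ) (S : Finset ℕ) :
    (F.relabel e).quot (S.map e) = (F.quot S).relabel e := by
  rw [quot, quot, ← relabel_restrict, relabel_lab, Finset.map_sdiff]

theorem subforests_relabel (F : LabeledForest) (e : ℕ ↪ ℕ) :
    (F.relabel e).subforests = F.subforests.map (Finset.mapEmbedding e).toEmbedding := by
  ext T
  simp only [Finset.mem_map, mem_subforests, relabel_lab, relabel_parent_iff]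
  constructor
  · rintro ⟨h1, h2⟩
    obtain ⟨S, hS, rfl⟩ := Finset.subset_map_iff.1 h1
    refine ⟨S, ⟨hS, fun v w hvw hw => ?_⟩, rfl⟩
    simpa using h2 (e v) (e w) ⟨v, w, rfl, rfl, hvw⟩ (by simpa using hw)
  · rintro ⟨S, ⟨hS, hcl⟩, rfl⟩
    refine ⟨Finset.map_subset_map.2 hS, ?_⟩
    rintro _ _ ⟨a, b, rfl, rfl, h⟩ hb
    simpa using hcl a b h (by simpa using hb)

/-- This is what makes the convolution product independent of the chosen representative of a class.
-/
theorem sum_subforests_relabel {M : Type*} [AddCommMonoid M] (F : LabeledForest) (e : ℕ ↪ ℕ)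
    (φ : IsoClass → IsoClass → M) :
    ∑ S ∈ (F.relabel e).subforests,
        φ ((F.relabel e).restrict S).cls ((F.relabel e).quot S).cls =
      ∑ S ∈ F.subforests, φ (F.restrict S).cls (F.quot S).cls := by
  rw [subforests_relabel, Finset.sum_map]
  refine Finset.sum_congr rfl fun S _ => ?_
  have : (Finset.mapEmbedding e).toEmbedding S = S.map e := rfl
  rw [this, relabel_restrict, relabel_quot, cls_relabel, cls_relabel]

theorem card_lab_eq_of_cls_eq {F G : LabeledForest} (h : F.cls = G.cls) :
    F.lab.card = G.lab.card := by
  obtain ⟨τ, rfl⟩ := cls_eq_iff.1 h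
  simp

/-! ### Disjoint unions -/

/-- The empty forest. -/
def empty : LabeledForest where
  lab := ∅
  parent _ := none
  parent_mem := by simp
  acyclic v h := by
    cases h with
    | single h => simp at h
    | tail _ h => simp at h

theorem eq_empty_of_lab {F : LabeledForest} (h : F.lab = ∅) : F = empty := by
  refine ext_rel h fun v w => ?_
  simp only [empty, reduceCtorEq, iff_false]
  intro hv
  have := (F.parent_mem v w hv).1
  simp [h] at this

theorem oplus_parent_iff (F G : LabeledForest) (x y : ℕ) :
    (F.oplus G).parent x = some y ↔
      (∃ a b, x = 2 * a ∧ y = 2 * b ∧ F.parent a = some b) ∨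
      (∃ a b, x = 2 * a + 1 ∧ y = 2 * b + 1 ∧ G.parent a = some b) := by
  simp only [oplus, sumParent]
  split_ifs with h
  · rw [Option.map_eq_some_iff]
    constructor
    · rintro ⟨b, hb, rfl⟩
      exact Or.inl ⟨x / 2, b, by omega, rfl, hb⟩
    · rintro (⟨a, b, rfl, rfl, h'⟩ | ⟨a, b, rfl, rfl, h'⟩)
      · exact ⟨b, by simpa using h', rfl⟩
      · omega
  · rw [Option.map_eq_some_iff]
    constructor
    · rintro ⟨b, hb, rfl⟩
      exact Or.inr ⟨x / 2, b, by omega, rfl, hb⟩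
    · rintro (⟨a, b, rfl, rfl, h'⟩ | ⟨a, b, rfl, rfl, h'⟩)
      · omega
      · refine ⟨b, ?_, rfl⟩
        rwa [show (2 * a + 1) / 2 = a by omega]

/-- The set of labels of a disjoint union. -/
def sumLab (S T : Finset ℕ) : Finset ℕ :=
  S.image (fun v => 2 * v) ∪ T.image (fun v => 2 * v + 1)

theorem oplus_lab (F G : LabeledForest) : (F.oplus G).lab = sumLab F.lab G.lab := rfl

theorem two_mul_mem_sumLab {S T : Finset ℕ} {v : ℕ} : 2 * v ∈ sumLab S T ↔ v ∈ S := by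
  simp only [sumLab, Finset.mem_union, Finset.mem_image]
  constructor
  · rintro (⟨a, ha, h⟩ | ⟨a, ha, h⟩)
    · rwa [show v = a by omega]
    · omega
  · exact fun h => Or.inl ⟨v, h, rfl⟩

theorem two_mul_add_one_mem_sumLab {S T : Finset ℕ} {v : ℕ} :
    2 * v + 1 ∈ sumLab S T ↔ v ∈ T := by
  simp only [sumLab, Finset.mem_union, Finset.mem_image]
  constructor
  · rintro (⟨a, ha, h⟩ | ⟨a, ha, h⟩)
    · omega
    · rwa [show v = a by omega]
  · exact fun h => Or.inr ⟨v, h, rfl⟩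

theorem forall_two_mul {p : ℕ → Prop} (h₀ : ∀ v, p (2 * v)) (h₁ : ∀ v, p (2 * v + 1)) (v : ℕ) :
    p v := by
  rcases Nat.even_or_odd' v with ⟨a, rfl | rfl⟩
  exacts [h₀ a, h₁ a]

theorem ext_two_mul {S T : Finset ℕ} (h₀ : ∀ v, 2 * v ∈ S ↔ 2 * v ∈ T)
    (h₁ : ∀ v, 2 * v + 1 ∈ S ↔ 2 * v + 1 ∈ T) : S = T :=
  Finset.ext (forall_two_mul h₀ h₁)

theorem sumLab_inj {S T S' T' : Finset ℕ} (h : sumLab S T = sumLab S' T') : S = S' ∧ T = T' :=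
  ⟨Finset.ext fun v => by rw [← two_mul_mem_sumLab (T := T), h, two_mul_mem_sumLab],
   Finset.ext fun v => by
    rw [← two_mul_add_one_mem_sumLab (S := S), h, two_mul_add_one_mem_sumLab]⟩

theorem exists_eq_sumLab (S : Finset ℕ) : ∃ S₁ S₂, S = sumLab S₁ S₂ := by
  refine ⟨(S.filter (· % 2 = 0)).image (· / 2), (S.filter (· % 2 = 1)).image (· / 2),
    ext_two_mul (fun v => ?_) fun v => ?_⟩
  · simp only [two_mul_mem_sumLab, Finset.mem_image, Finset.mem_filter]
    constructor
    · exact fun h => ⟨2 * v, ⟨h, by omega⟩, by omega⟩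
    · rintro ⟨a, ⟨ha, h⟩, h'⟩
      rwa [show 2 * v = a by omega]
  · simp only [two_mul_add_one_mem_sumLab, Finset.mem_image, Finset.mem_filter]
    constructor
    · exact fun h => ⟨2 * v + 1, ⟨h, by omega⟩, by omega⟩
    · rintro ⟨a, ⟨ha, h⟩, h'⟩
      rwa [show 2 * v + 1 = a by omega]

theorem sumLab_inter (S T S' T' : Finset ℕ) :
    sumLab S T ∩ sumLab S' T' = sumLab (S ∩ S') (T ∩ T') := by
  refine ext_two_mul (fun v => ?_) fun v => ?_ <;>
  simp only [Finset.mem_inter, two_mul_mem_sumLab, two_mul_add_one_mem_sumLab]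

theorem sumLab_sdiff (S T S' T' : Finset ℕ) :
    sumLab S T \ sumLab S' T' = sumLab (S \ S') (T \ T') := by
  refine ext_two_mul (fun v => ?_) fun v => ?_ <;>
  simp only [Finset.mem_sdiff, two_mul_mem_sumLab, two_mul_add_one_mem_sumLab]

theorem card_sumLab (S T : Finset ℕ) : (sumLab S T).card = S.card + T.card := by
  rw [sumLab, Finset.card_union_of_disjoint, Finset.card_image_of_injective,
    Finset.card_image_of_injective]
  · intro a b h; simpa using h
  · intro a b h; simpa using h
  · rw [Finset.disjoint_left]
    intro x hx hy
    obtain ⟨a, _, rfl⟩ := Finset.mem_image.1 hx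
    obtain ⟨b, _, hb⟩ := Finset.mem_image.1 hy
    omega

theorem sumLab_subset {S T S' T' : Finset ℕ} :
    sumLab S T ⊆ sumLab S' T' ↔ S ⊆ S' ∧ T ⊆ T' := by
  constructor
  · intro h
    refine ⟨fun v hv => ?_, fun v hv => ?_⟩
    · exact two_mul_mem_sumLab.1 (h (two_mul_mem_sumLab.2 hv))
    · exact two_mul_add_one_mem_sumLab.1 (h (two_mul_add_one_mem_sumLab.2 hv))
  · rintro ⟨h1, h2⟩
    refine forall_two_mul (fun v => ?_) fun v => ?_
    · rw [two_mul_mem_sumLab, two_mul_mem_sumLab]; exact @h1 v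
    · rw [two_mul_add_one_mem_sumLab, two_mul_add_one_mem_sumLab]; exact @h2 v

theorem oplus_restrict (F G : LabeledForest) (S T : Finset ℕ) :
    (F.oplus G).restrict (sumLab S T) = (F.restrict S).oplus (G.restrict T) := by
  refine ext_rel (by simp only [restrict_lab, oplus_lab, sumLab_inter]) fun x y => ?_
  simp only [restrict_parent_iff, oplus_parent_iff]
  constructor
  · rintro ⟨h1, h2, ⟨a, b, rfl, rfl, h⟩ | ⟨a, b, rfl, rfl, h⟩⟩
    · rw [two_mul_mem_sumLab] at h1 h2
      exact Or.inl ⟨a, b, rfl, rfl, h1, h2, h⟩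
    · rw [two_mul_add_one_mem_sumLab] at h1 h2
      exact Or.inr ⟨a, b, rfl, rfl, h1, h2, h⟩
  · rintro (⟨a, b, rfl, rfl, h1, h2, h⟩ | ⟨a, b, rfl, rfl, h1, h2, h⟩)
    · simp only [two_mul_mem_sumLab]
      exact ⟨h1, h2, Or.inl ⟨a, b, rfl, rfl, h⟩⟩
    · simp only [two_mul_add_one_mem_sumLab]
      exact ⟨h1, h2, Or.inr ⟨a, b, rfl, rfl, h⟩⟩

theorem oplus_quot (F G : LabeledForest) (S T : Finset ℕ) :
    (F.oplus G).quot (sumLab S T) = (F.quot S).oplus (G.quot T) := by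
  rw [quot, oplus_lab, sumLab_sdiff, oplus_restrict, quot, quot]

theorem sumLab_mem_subforests {F G : LabeledForest} {S T : Finset ℕ} :
    sumLab S T ∈ (F.oplus G).subforests ↔ S ∈ F.subforests ∧ T ∈ G.subforests := by
  simp only [mem_subforests, oplus_lab, sumLab_subset, oplus_parent_iff]
  constructor
  · rintro ⟨⟨h1, h2⟩, h⟩
    refine ⟨⟨h1, fun v w hvw hw => ?_⟩, h2, fun v w hvw hw => ?_⟩
    · exact two_mul_mem_sumLab.1 (h _ _ (Or.inl ⟨v, w, rfl, rfl, hvw⟩) (two_mul_mem_sumLab.2 hw))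
    · exact two_mul_add_one_mem_sumLab.1
        (h _ _ (Or.inr ⟨v, w, rfl, rfl, hvw⟩) (two_mul_add_one_mem_sumLab.2 hw))
  · rintro ⟨⟨h1, h2⟩, h3, h4⟩
    refine ⟨⟨h1, h3⟩, ?_⟩
    rintro _ _ (⟨a, b, rfl, rfl, h⟩ | ⟨a, b, rfl, rfl, h⟩) hb
    · rw [two_mul_mem_sumLab] at *; exact h2 _ _ h hb
    · rw [two_mul_add_one_mem_sumLab] at *; exact h4 _ _ h hb

theorem sum_subforests_oplus {M : Type*} [AddCommMonoid M] (F G : LabeledForest)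
    (φ : Finset ℕ → M) :
    ∑ S ∈ (F.oplus G).subforests, φ S =
      ∑ S ∈ F.subforests, ∑ T ∈ G.subforests, φ (sumLab S T) := by
  rw [← Finset.sum_product']
  symm
  refine Finset.sum_bij (fun p _ => sumLab p.1 p.2) ?_ ?_ ?_ fun _ _ => rfl
  · intro p hp
    rw [Finset.mem_product] at hp
    exact sumLab_mem_subforests.2 hp
  · intro p _ q _ h
    exact Prod.ext (sumLab_inj h).1 (sumLab_inj h).2
  · intro S hS
    obtain ⟨S₁, S₂, rfl⟩ := exists_eq_sumLab S
    exact ⟨(S₁, S₂), Finset.mem_product.2 (sumLab_mem_subforests.1 hS), rfl⟩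

/-- The embedding that acts by `e` on even numbers and by `e'` on odd numbers. -/
def sumEmb (e e' : ℕ ↪ ℕ) : ℕ ↪ ℕ where
  toFun v := if v % 2 = 0 then 2 * e (v / 2) else 2 * e' (v / 2) + 1
  inj' v w h := by
    dsimp only at h
    split_ifs at h with h1 h2 h2
    · have := e.injective (show e (v / 2) = e (w / 2) by omega); omega
    · omega
    · omega
    · have := e'.injective (show e' (v / 2) = e' (w / 2) by omega); omega

theorem sumEmb_apply (e e' : ℕ ↪ ℕ) (v : ℕ) :
    sumEmb e e' v = if v % 2 = 0 then 2 * e (v / 2) else 2 * e' (v / 2) + 1 := rfl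

theorem sumEmb_two_mul (e e' : ℕ ↪ ℕ) (v : ℕ) : sumEmb e e' (2 * v) = 2 * e v := by
  simp [sumEmb_apply]

theorem sumEmb_two_mul_add_one (e e' : ℕ ↪ ℕ) (v : ℕ) :
    sumEmb e e' (2 * v + 1) = 2 * e' v + 1 := by
  simp [sumEmb_apply, show (2 * v + 1) / 2 = v by omega]

/-- A criterion for a disjoint union to be isomorphic to a given forest. -/
theorem cls_oplus_eq {F G H : LabeledForest} (e : ℕ ↪ ℕ)
    (hlab : ∀ x, x ∈ H.lab ↔ (∃ a ∈ F.lab, e (2 * a) = x) ∨ ∃ a ∈ G.lab, e (2 * a + 1) = x)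
    (hpar : ∀ x y, H.parent x = some y ↔
      (∃ a b, e (2 * a) = x ∧ e (2 * b) = y ∧ F.parent a = some b) ∨
      ∃ a b, e (2 * a + 1) = x ∧ e (2 * b + 1) = y ∧ G.parent a = some b) :
    (F.oplus G).cls = H.cls := by
  rw [cls_eq_iff]
  refine ⟨e, ext_rel ?_ fun x y => ?_⟩
  · ext x
    rw [hlab, relabel_lab, oplus_lab, sumLab]
    simp only [Finset.mem_map, Finset.mem_union, Finset.mem_image]
    grind
  · rw [hpar, relabel_parent_iff]
    simp only [oplus_parent_iff]
    grind

theorem cls_oplus_congr {F F' G G' : LabeledForest} (h : F.cls = F'.cls) (h' : G.cls = G'.cls) :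
    (F.oplus G).cls = (F'.oplus G').cls := by
  obtain ⟨τ, rfl⟩ := cls_eq_iff.1 h
  obtain ⟨τ', rfl⟩ := cls_eq_iff.1 h'
  refine cls_oplus_eq (sumEmb τ τ') (fun x => ?_) fun x y => ?_
  · simp only [sumEmb_two_mul, sumEmb_two_mul_add_one, oplus_lab, sumLab, relabel_lab,
      Finset.mem_union, Finset.mem_image, Finset.mem_map]
    grind
  · simp only [sumEmb_two_mul, sumEmb_two_mul_add_one, oplus_parent_iff, relabel_parent_iff]
    grind

theorem cls_oplus_comm (F G : LabeledForest) : (F.oplus G).cls = (G.oplus F).cls := by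
  -- The involution that swaps 2a and 2a + 1.
  obtain ⟨e, he⟩ : ∃ e : ℕ ↪ ℕ, ∀ v, e v = if v % 2 = 0 then v + 1 else v - 1 :=
    ⟨⟨fun v => if v % 2 = 0 then v + 1 else v - 1, fun v w h => by
      dsimp only at h; split_ifs at h <;> omega⟩, fun _ => rfl⟩
  have h₀ : ∀ a, e (2 * a) = 2 * a + 1 := by intro a; rw [he]; simp
  have h₁ : ∀ a, e (2 * a + 1) = 2 * a := by intro a; rw [he]; simp
  refine cls_oplus_eq e (fun x => ?_) fun x y => ?_
  · simp only [h₀, h₁, oplus_lab, sumLab, Finset.mem_union, Finset.mem_image]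
    grind
  · simp only [h₀, h₁, oplus_parent_iff]
    grind

theorem cls_oplus_assoc (F G H : LabeledForest) :
    ((F.oplus G).oplus H).cls = (F.oplus (G.oplus H)).cls := by
  -- On the left F, G, H occupy the numbers 4a, 4a + 2, 2a + 1; on the right they occupy 2a, 4a + 1,
  -- 4a + 3.
  obtain ⟨e, he⟩ : ∃ e : ℕ ↪ ℕ, ∀ v, e v =
      if v % 4 = 0 then v / 2 else if v % 4 = 2 then v - 1 else 2 * v + 1 :=
    ⟨⟨fun v => if v % 4 = 0 then v / 2 else if v % 4 = 2 then v - 1 else 2 * v + 1, fun v w h => by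
      dsimp only at h; split_ifs at h <;> omega⟩, fun _ => rfl⟩
  have h₀ : ∀ a, e (2 * (2 * a)) = 2 * a := by intro a; rw [he]; split_ifs <;> omega
  have h₁ : ∀ a, e (2 * (2 * a + 1)) = 2 * (2 * a) + 1 := by
    intro a; rw [he]; split_ifs <;> omega
  have h₂ : ∀ a, e (2 * a + 1) = 2 * (2 * a + 1) + 1 := by intro a; rw [he]; split_ifs <;> omega
  refine cls_oplus_eq e (fun x => ?_) fun x y => ?_
  · simp only [oplus_lab, sumLab, Finset.mem_union, Finset.mem_image]
    grind
  · simp only [oplus_parent_iff]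
    grind

theorem cls_empty_oplus (F : LabeledForest) : (empty.oplus F).cls = F.cls := by
  symm
  rw [cls_eq_iff]
  obtain ⟨e, he⟩ : ∃ e : ℕ ↪ ℕ, ∀ v, e v = 2 * v + 1 :=
    ⟨⟨_, fun v w h => by simpa using h⟩, fun _ => rfl⟩
  refine ⟨e, ext_rel ?_ fun x y => ?_⟩
  · ext x
    simp [oplus_lab, sumLab, empty, he]
  · simp only [oplus_parent_iff, relabel_parent_iff, empty, he]
    grind

/-- A forest that is the union of a subforest and a quotient not linked by any edge. -/
theorem cls_eq_oplus_of_closed {F : LabeledForest} {S : Finset ℕ}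
    (hS : ∀ v w, F.parent v = some w → (v ∈ S ↔ w ∈ S)) :
    ((F.restrict S).oplus (F.quot S)).cls = F.cls := by
  symm
  rw [cls_eq_iff]
  obtain ⟨e, he⟩ : ∃ e : ℕ ↪ ℕ, ∀ v, e v = if v ∈ S then 2 * v else 2 * v + 1 :=
    ⟨⟨fun v => if v ∈ S then 2 * v else 2 * v + 1, fun v w h => by
      dsimp only at h; split_ifs at h <;> omega⟩, fun _ => rfl⟩
  have h₀ : ∀ a ∈ S, e a = 2 * a := fun a ha => by rw [he, if_pos ha]
  have h₁ : ∀ a ∉ S, e a = 2 * a + 1 := fun a ha => by rw [he, if_neg ha]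
  refine ⟨e, ext_rel ?_ fun x y => ?_⟩
  · ext x
    simp only [oplus_lab, sumLab, relabel_lab, restrict_lab, quot, Finset.mem_union,
      Finset.mem_image, Finset.mem_map, Finset.mem_inter, Finset.mem_sdiff]
    grind
  · simp only [oplus_parent_iff, relabel_parent_iff, quot, restrict_parent_iff, Finset.mem_sdiff]
    have := F.parent_mem
    grind

end LabeledForest

/-! ### Roots and branches -/

namespace LabeledForest

/-- The roots of a forest. -/
def roots (F : LabeledForest) : Finset ℕ := F.lab.filter fun v => F.parent v = none

theorem mem_roots {F : LabeledForest} {v : ℕ} : v ∈ F.roots ↔ v ∈ F.lab ∧ F.parent v = none :=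
  Finset.mem_filter

theorem isTree_iff {F : LabeledForest} : F.IsTree ↔ ∃ r, F.roots = {r} := by
  simp only [IsTree, ← mem_roots, Finset.eq_singleton_iff_unique_mem]
  rfl

theorem roots_relabel (F : LabeledForest) (e : ℕ ↪ ℕ) : (F.relabel e).roots = F.roots.map e := by
  ext x
  simp only [mem_roots, relabel_lab, Finset.mem_map]
  constructor
  · rintro ⟨⟨a, ha, rfl⟩, h⟩
    exact ⟨a, ⟨ha, (F.relabel_parent_eq_none_iff e a).1 h⟩, rfl⟩
  · rintro ⟨a, ⟨ha, h⟩, rfl⟩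
    exact ⟨⟨a, ha, rfl⟩, (F.relabel_parent_eq_none_iff e a).2 h⟩

theorem roots_oplus (F G : LabeledForest) : (F.oplus G).roots = sumLab F.roots G.roots := by
  refine ext_two_mul (fun v => ?_) fun v => ?_
  · rw [two_mul_mem_sumLab, mem_roots, mem_roots, oplus_lab, two_mul_mem_sumLab]
    simp [oplus, sumParent]
  · rw [two_mul_add_one_mem_sumLab, mem_roots, mem_roots, oplus_lab, two_mul_add_one_mem_sumLab]
    simp [oplus, sumParent, show (2 * v + 1) / 2 = v by omega]

theorem roots_restrict_inter_subset (F : LabeledForest) (S : Finset ℕ) :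
    F.roots ∩ S ⊆ (F.restrict S).roots := by
  intro v hv
  rw [Finset.mem_inter, mem_roots] at hv
  rw [mem_roots, restrict_parent_eq_none_iff, restrict_lab, Finset.mem_inter]
  exact ⟨⟨hv.1.1, hv.2⟩, fun _ w hw => by simp [hv.1.2] at hw⟩

theorem roots_quot {F : LabeledForest} {S : Finset ℕ} (hS : S ∈ F.subforests) :
    (F.quot S).roots = F.roots \ S := by
  rw [mem_subforests] at hS
  ext v
  rw [mem_roots, Finset.mem_sdiff, mem_roots, quot, restrict_parent_eq_none_iff, restrict_lab,
    Finset.mem_inter, Finset.mem_sdiff, Option.eq_none_iff_forall_ne_some]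
  constructor
  · rintro ⟨⟨h1, -, h2⟩, h⟩
    refine ⟨⟨h1, fun w hw => h ⟨h1, h2⟩ w hw ?_⟩, h2⟩
    exact Finset.mem_sdiff.2 ⟨(F.parent_mem v w hw).2, fun hw' => h2 (hS.2 v w hw hw')⟩
  · rintro ⟨⟨h1, h⟩, h2⟩
    exact ⟨⟨h1, h1, h2⟩, fun _ w hw => absurd hw (h w)⟩

/-- Every root of `F` stays a root in the piece that contains it, while the part cut off may acquire
new roots. This inequality is the source of the filtration by number of components used for
triangularity. -/
theorem card_roots_le {F : LabeledForest} {S : Finset ℕ} (hS : S ∈ F.subforests) :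
    F.roots.card ≤ (F.restrict S).roots.card + (F.quot S).roots.card := by
  rw [roots_quot hS, ← Finset.card_inter_add_card_sdiff F.roots S]
  exact Nat.add_le_add_right (Finset.card_le_card (roots_restrict_inter_subset F S)) _

/-- A subforest is split off if it contributes no new roots. -/
theorem cls_eq_oplus_of_card_roots {F : LabeledForest} {S : Finset ℕ} (hS : S ∈ F.subforests)
    (h : (F.restrict S).roots.card + (F.quot S).roots.card ≤ F.roots.card) :
    ((F.restrict S).oplus (F.quot S)).cls = F.cls := by
  have h' : F.roots ∩ S = (F.restrict S).roots := by
    refine Finset.eq_of_subset_of_card_le (roots_restrict_inter_subset F S) ?_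
    rw [roots_quot hS, ← Finset.card_inter_add_card_sdiff F.roots S] at h
    omega
  rw [mem_subforests] at hS
  refine cls_eq_oplus_of_closed fun v w hvw => ⟨fun hv => ?_, hS.2 v w hvw⟩
  -- A vertex of `S` whose parent lies outside `S` would be a root of the restriction without being
  -- a root of `F`, against `h'`.
  by_contra hw
  have : v ∈ (F.restrict S).roots := by
    rw [mem_roots, restrict_parent_eq_none_iff, restrict_lab, Finset.mem_inter]
    refine ⟨⟨hS.1 hv, hv⟩, fun _ x hx => ?_⟩
    rw [hvw, Option.some.injEq] at hx
    exact hx ▸ hw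
  rw [← h', Finset.mem_inter, mem_roots, hvw] at this
  simp at this

theorem mem_prunedLab_singleton {F : LabeledForest} {r v : ℕ} :
    v ∈ F.prunedLab {r} ↔ v ∈ F.lab ∧ F.Below v r := by
  simp [prunedLab]

theorem below_antisymm {F : LabeledForest} {v w : ℕ} (h : F.Below v w) (h' : F.Below w v) :
    v = w := by
  rcases Relation.reflTransGen_iff_eq_or_transGen.1 h with h | h
  · exact h.symm
  · exact absurd (h.trans_left h') (F.acyclic v)

theorem eq_of_below_of_root {F : LabeledForest} {v w : ℕ} (h : F.Below v w)
    (hv : F.parent v = none) : v = w := by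
  rcases Relation.ReflTransGen.cases_head h with h | ⟨x, hx, -⟩
  · exact h
  · simp [hv] at hx

/-- Parents are unique, so the vertices above `v` form a chain, and a root can only be its top. -/
theorem root_unique {F : LabeledForest} {v r s : ℕ} (hr : F.Below v r) (hs : F.Below v s)
    (hr' : F.parent r = none) (hs' : F.parent s = none) : r = s := by
  rcases Relation.ReflTransGen.total_of_right_unique
    (fun a b c hb hc => Option.some.inj (hb.symm.trans hc)) hr hs with h | h
  · exact eq_of_below_of_root h hr'
  · exact (eq_of_below_of_root h hs').symm

/-- The whole vertex set is a subforest, so it is cut off by some admissible `C`. Members of `C` are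
roots: a parent of c ∈ C would lie below some d ∈ C, admissibility gives c = d, and that is a cycle.
-/
theorem exists_root_above {F : LabeledForest} {v : ℕ} (hv : v ∈ F.lab) :
    ∃ r ∈ F.roots, F.Below v r := by
  obtain ⟨C, hC, h⟩ := (exists_prunedLab_iff F F.lab).2
    ⟨subset_rfl, fun v w h _ => (F.parent_mem v w h).1⟩
  have hC' : ∀ w ∈ F.lab, ∃ c ∈ C, F.Below w c := by
    classical
    intro w hw
    rw [h, prunedLab, Finset.mem_filter] at hw
    exact hw.2
  obtain ⟨c, hc, hvc⟩ := hC' v hv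
  refine ⟨c, mem_roots.2 ⟨hC.1 hc, ?_⟩, hvc⟩
  rw [Option.eq_none_iff_forall_ne_some]
  intro w hw
  obtain ⟨d, hd, hwd⟩ := hC' w (F.parent_mem c w hw).2
  have := hC.2 c hc d hd (.head hw hwd)
  subst this
  exact F.acyclic c (.head' hw hwd)

theorem prunedLab_mem_subforests {F : LabeledForest} {r : ℕ} :
    F.prunedLab {r} ∈ F.subforests := by
  rw [mem_subforests]
  refine ⟨fun v hv => (mem_prunedLab_singleton.1 hv).1, fun v w h hw => ?_⟩
  rw [mem_prunedLab_singleton] at hw ⊢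
  exact ⟨(F.parent_mem v w h).1, .head h hw.2⟩

theorem eq_empty_of_roots {F : LabeledForest} (h : F.roots = ∅) : F = empty := by
  apply eq_empty_of_lab
  by_contra hF
  obtain ⟨v, hv⟩ := Finset.nonempty_iff_ne_empty.2 hF
  obtain ⟨r, hr, -⟩ := exists_root_above hv
  simp [h] at hr

theorem roots_pruned {F : LabeledForest} {r : ℕ} (hr : r ∈ F.lab) : (F.pruned {r}).roots = {r} := by
  rw [Finset.eq_singleton_iff_unique_mem]
  simp only [mem_roots, pruned, restrict_lab, restrict_parent_eq_none_iff, Finset.mem_inter,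
    mem_prunedLab_singleton]
  refine ⟨⟨⟨hr, hr, .refl⟩, fun _ w hw hw' => ?_⟩, ?_⟩
  · exact F.acyclic r (.head' hw hw'.2)
  · rintro v ⟨⟨-, hv, hvr⟩, h⟩
    rcases Relation.ReflTransGen.cases_head hvr with h' | ⟨w, hw, hwr⟩
    · exact h'
    · exact absurd ⟨(F.parent_mem v w hw).2, hwr⟩ (h ⟨hv, hvr⟩ w hw)

theorem pruned_isTree {F : LabeledForest} {r : ℕ} (hr : r ∈ F.lab) : (F.pruned {r}).IsTree :=
  isTree_iff.2 ⟨r, roots_pruned hr⟩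

/-- No edge joins the tree of a root to the rest: the parent of a vertex below `r` has a root above
it, which must be `r` by uniqueness. This peels off one component and drives the inductions on the
number of components. -/
theorem cls_pruned_oplus_trunk {F : LabeledForest} {r : ℕ} (hr : r ∈ F.roots) :
    ((F.pruned {r}).oplus (F.trunk {r})).cls = F.cls := by
  refine cls_eq_oplus_of_closed (S := F.prunedLab {r}) fun v w hvw => ?_
  rw [mem_prunedLab_singleton, mem_prunedLab_singleton]
  have hm := F.parent_mem v w hvw
  refine ⟨fun h => ⟨hm.2, ?_⟩, fun h => ⟨hm.1, .head hvw h.2⟩⟩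
  obtain ⟨s, hs, hws⟩ := exists_root_above hm.2
  rw [mem_roots] at hr hs
  rwa [root_unique h.2 (.head hvw hws) hr.2 hs.2]

theorem pruned_eq_self {T : LabeledForest} {r : ℕ} (h : T.roots = {r}) : T.pruned {r} = T := by
  have : T.prunedLab {r} = T.lab := by
    ext v
    rw [mem_prunedLab_singleton, and_iff_left_iff_imp]
    intro hv
    obtain ⟨s, hs, hvs⟩ := exists_root_above hv
    rw [h, Finset.mem_singleton] at hs
    exact hs ▸ hvs
  rw [pruned, this, restrict_self]

/-! ### Components as a complete isomorphism invariant -/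

/-- The isomorphism classes of the components of a forest. -/
noncomputable def components (F : LabeledForest) : Multiset IsoClass :=
  F.roots.val.map fun r => (F.pruned {r}).cls

theorem card_components (F : LabeledForest) : F.components.card = F.roots.card := by
  simp [components]

theorem components_eq_of_isTree {T : LabeledForest} (hT : T.IsTree) : T.components = {T.cls} := by
  obtain ⟨r, hr⟩ := isTree_iff.1 hT
  simp [components, hr, pruned_eq_self hr]

theorem components_eq_zero_iff {F : LabeledForest} : F.components = 0 ↔ F = empty := by
  constructor
  · intro h
    apply eq_empty_of_roots
    rw [← Finset.card_eq_zero, ← card_components, h, Multiset.card_zero]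
  · rintro rfl
    rfl

theorem exists_isTree_of_mem_components {F : LabeledForest} {x : IsoClass}
    (h : x ∈ F.components) : ∃ T : LabeledForest, T.IsTree ∧ T.cls = x := by
  obtain ⟨r, hr, rfl⟩ := Multiset.mem_map.1 h
  exact ⟨_, pruned_isTree (mem_roots.1 hr).1, rfl⟩

theorem below_relabel_iff (F : LabeledForest) (e : ℕ ↪ ℕ) {v w : ℕ} :
    (F.relabel e).Below (e v) (e w) ↔ F.Below v w := by
  constructor
  · intro h
    have : ∀ x, (F.relabel e).Below (e v) x → ∃ a, e a = x ∧ F.Below v a := by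
      intro x hx
      induction hx with
      | refl => exact ⟨v, rfl, .refl⟩
      | tail _ h ih =>
        obtain ⟨a, rfl, ha⟩ := ih
        obtain ⟨b, c, hb, rfl, hbc⟩ := (relabel_parent_iff _ _ _ _).1 h
        exact ⟨c, rfl, ha.tail (e.injective hb ▸ hbc)⟩
    obtain ⟨a, ha, h⟩ := this _ h
    exact e.injective ha ▸ h
  · intro h
    induction h with
    | refl => exact .refl
    | tail _ h ih => exact ih.tail ((relabel_parent_apply_iff _ _ _ _).2 h)

theorem prunedLab_relabel (F : LabeledForest) (e : ℕ ↪ ℕ) (r : ℕ) :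
    (F.relabel e).prunedLab {e r} = (F.prunedLab {r}).map e := by
  ext x
  simp only [mem_prunedLab_singleton, relabel_lab, Finset.mem_map]
  constructor
  · rintro ⟨⟨a, ha, rfl⟩, h⟩
    exact ⟨a, ⟨ha, (below_relabel_iff F e).1 h⟩, rfl⟩
  · rintro ⟨a, ⟨ha, h⟩, rfl⟩
    exact ⟨⟨a, ha, rfl⟩, (below_relabel_iff F e).2 h⟩

theorem components_relabel (F : LabeledForest) (e : ℕ ↪ ℕ) :
    (F.relabel e).components = F.components := by
  rw [components, roots_relabel, Finset.map_val, Multiset.map_map, components]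
  refine Multiset.map_congr rfl fun r _ => ?_
  simp only [Function.comp_apply]
  rw [pruned, prunedLab_relabel, relabel_restrict, cls_relabel, pruned]

theorem components_eq_of_cls_eq {F G : LabeledForest} (h : F.cls = G.cls) :
    F.components = G.components := by
  obtain ⟨τ, rfl⟩ := cls_eq_iff.1 h
  exact (components_relabel F τ).symm

theorem below_oplus_left (F G : LabeledForest) {v x : ℕ} :
    (F.oplus G).Below (2 * v) x ↔ ∃ a, x = 2 * a ∧ F.Below v a := by
  constructor
  · intro hx
    induction hx with
    | refl => exact ⟨v, rfl, .refl⟩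
    | tail _ h ih =>
      obtain ⟨a, rfl, ha⟩ := ih
      rcases (oplus_parent_iff _ _ _ _).1 h with ⟨b, c, hb, rfl, hbc⟩ | ⟨b, c, hb, rfl, hbc⟩
      · exact ⟨c, rfl, ha.tail ((show a = b by omega) ▸ hbc)⟩
      · omega
  · rintro ⟨a, rfl, h⟩
    induction h with
    | refl => exact .refl
    | tail _ h ih => exact ih.tail ((oplus_parent_iff _ _ _ _).2 (Or.inl ⟨_, _, rfl, rfl, h⟩))

theorem below_oplus_right (F G : LabeledForest) {v x : ℕ} :
    (F.oplus G).Below (2 * v + 1) x ↔ ∃ a, x = 2 * a + 1 ∧ G.Below v a := by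
  constructor
  · intro hx
    induction hx with
    | refl => exact ⟨v, rfl, .refl⟩
    | tail _ h ih =>
      obtain ⟨a, rfl, ha⟩ := ih
      rcases (oplus_parent_iff _ _ _ _).1 h with ⟨b, c, hb, rfl, hbc⟩ | ⟨b, c, hb, rfl, hbc⟩
      · omega
      · exact ⟨c, rfl, ha.tail ((show a = b by omega) ▸ hbc)⟩
  · rintro ⟨a, rfl, h⟩
    induction h with
    | refl => exact .refl
    | tail _ h ih => exact ih.tail ((oplus_parent_iff _ _ _ _).2 (Or.inr ⟨_, _, rfl, rfl, h⟩))

theorem cls_oplus_empty (F : LabeledForest) : (F.oplus empty).cls = F.cls :=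
  (cls_oplus_comm F empty).trans (cls_empty_oplus F)

theorem restrict_empty (F : LabeledForest) : F.restrict ∅ = empty :=
  eq_empty_of_lab (by simp)

theorem components_oplus (F G : LabeledForest) :
    (F.oplus G).components = F.components + G.components := by
  have hval : (sumLab F.roots G.roots).val =
      F.roots.val.map (fun v => 2 * v) + G.roots.val.map (fun v => 2 * v + 1) := by
    rw [sumLab, ← Finset.disjUnion_eq_union, Finset.disjUnion_val,
      Finset.image_val_of_injOn, Finset.image_val_of_injOn]
    · intro a _ b _ h; simpa using h
    · intro a _ b _ h; simpa using h
    · rw [Finset.disjoint_left]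
      intro x hx hy
      obtain ⟨a, _, rfl⟩ := Finset.mem_image.1 hx
      obtain ⟨b, _, hb⟩ := Finset.mem_image.1 hy
      omega
  rw [components, roots_oplus, hval, Multiset.map_add, Multiset.map_map, Multiset.map_map]
  congr 1
  · refine Multiset.map_congr rfl fun r _ => ?_
    have : (F.oplus G).prunedLab {2 * r} = sumLab (F.prunedLab {r}) ∅ := by
      refine ext_two_mul (fun v => ?_) fun v => ?_
      · rw [two_mul_mem_sumLab, mem_prunedLab_singleton, mem_prunedLab_singleton, oplus_lab,
          two_mul_mem_sumLab, below_oplus_left]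
        simp
      · rw [two_mul_add_one_mem_sumLab, mem_prunedLab_singleton, below_oplus_right]
        simp only [Finset.notMem_empty, iff_false]
        rintro ⟨-, a, ha, -⟩
        omega
    simp only [Function.comp_apply]
    rw [pruned, this, oplus_restrict, restrict_empty, cls_oplus_empty, pruned]
  · refine Multiset.map_congr rfl fun r _ => ?_
    have : (F.oplus G).prunedLab {2 * r + 1} = sumLab ∅ (G.prunedLab {r}) := by
      refine ext_two_mul (fun v => ?_) fun v => ?_
      · rw [two_mul_mem_sumLab, mem_prunedLab_singleton, below_oplus_left]
        simp only [Finset.notMem_empty, iff_false]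
        rintro ⟨-, a, ha, -⟩
        omega
      · rw [two_mul_add_one_mem_sumLab, mem_prunedLab_singleton, mem_prunedLab_singleton, oplus_lab,
          two_mul_add_one_mem_sumLab, below_oplus_right]
        simp
    simp only [Function.comp_apply]
    rw [pruned, this, oplus_restrict, restrict_empty, cls_empty_oplus, pruned]

/-- A forest is determined up to isomorphism by its components. -/
theorem cls_eq_of_components_eq {F G : LabeledForest} (h : F.components = G.components) :
    F.cls = G.cls := by
  induction hn : F.roots.card generalizing F G with
  | zero =>
    rw [← card_components, Multiset.card_eq_zero] at hn
    rw [components_eq_zero_iff.1 hn, components_eq_zero_iff.1 (h.symm.trans hn)]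
  | succ n ih =>
    -- Peeling off the tree of a root removes one member of the multiset. Peel an isomorphic
    -- component from both forests; the multisets that remain agree again.
    have key : ∀ {H : LabeledForest} {r : ℕ}, r ∈ H.roots →
        H.components = (H.pruned {r}).cls ::ₘ (H.trunk {r}).components := by
      intro H r hr
      rw [← components_eq_of_cls_eq (cls_pruned_oplus_trunk hr), components_oplus,
        components_eq_of_isTree (pruned_isTree (mem_roots.1 hr).1), Multiset.singleton_add]
    obtain ⟨r, hr⟩ := Finset.card_pos.1 (show 0 < F.roots.card by omega)
    have hmem : (F.pruned {r}).cls ∈ G.components := by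
      rw [← h, key hr]
      exact Multiset.mem_cons_self _ _
    obtain ⟨s, hs, hrs⟩ := Multiset.mem_map.1 hmem
    have h1 := key hr
    have h2 := key (H := G) (r := s) hs
    rw [← h, h1, hrs, Multiset.cons_inj_right] at h2
    rw [← cls_pruned_oplus_trunk hr, ← cls_pruned_oplus_trunk (F := G) (r := s) hs]
    refine cls_oplus_congr hrs.symm (ih h2 ?_)
    rw [← card_components, h1, Multiset.card_cons, card_components] at hn
    omega

/-! ### The monoid of isomorphism classes -/

/-- The number of vertices. -/
noncomputable def IsoClass.size (x : IsoClass) : ℕ := x.out.lab.card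

theorem cls_out (x : IsoClass) : x.out.cls = x := Quotient.out_eq x

theorem exists_cls (x : IsoClass) : ∃ F : LabeledForest, F.cls = x := ⟨_, cls_out x⟩

theorem size_cls (F : LabeledForest) : F.cls.size = F.lab.card :=
  card_lab_eq_of_cls_eq (cls_out _)

/-- The components of an isomorphism class of forests. -/
noncomputable def IsoClass.comps (x : IsoClass) : Multiset IsoClass := x.out.components

theorem comps_cls (F : LabeledForest) : F.cls.comps = F.components :=
  components_eq_of_cls_eq (cls_out _)

noncomputable scoped instance : Zero IsoClass := ⟨empty.cls⟩

noncomputable scoped instance : Add IsoClass := ⟨fun x y => (x.out.oplus y.out).cls⟩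

/-- The classes of forests form a commutative monoid under the disjoint union. -/
noncomputable scoped instance : AddCommMonoid IsoClass where
  add_assoc x y z := by
    refine (cls_oplus_congr (cls_out _) rfl).trans ((cls_oplus_assoc _ _ _).trans ?_)
    exact (cls_oplus_congr rfl (cls_out _)).symm
  zero_add x := (cls_oplus_congr (cls_out _) rfl).trans ((cls_empty_oplus _).trans (cls_out _))
  add_zero x := (cls_oplus_congr rfl (cls_out _)).trans ((cls_oplus_empty _).trans (cls_out _))
  add_comm x y := cls_oplus_comm _ _
  nsmul := nsmulRec

theorem cls_oplus (F G : LabeledForest) : (F.oplus G).cls = F.cls + G.cls :=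
  (cls_oplus_congr (cls_out _) (cls_out _)).symm

theorem cls_empty : empty.cls = 0 := rfl

theorem size_add (x y : IsoClass) : (x + y).size = x.size + y.size := by
  obtain ⟨F, rfl⟩ := exists_cls x
  obtain ⟨G, rfl⟩ := exists_cls y
  rw [← cls_oplus, size_cls, size_cls, size_cls, oplus_lab, card_sumLab]

theorem size_eq_zero {x : IsoClass} : x.size = 0 ↔ x = 0 := by
  obtain ⟨F, rfl⟩ := exists_cls x
  rw [size_cls, Finset.card_eq_zero]
  constructor
  · intro h
    rw [eq_empty_of_lab h, cls_empty]
  · intro h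
    rw [← cls_empty] at h
    rw [← Finset.card_eq_zero, card_lab_eq_of_cls_eq h]
    rfl

theorem comps_add (x y : IsoClass) : (x + y).comps = x.comps + y.comps := by
  obtain ⟨F, rfl⟩ := exists_cls x
  obtain ⟨G, rfl⟩ := exists_cls y
  rw [← cls_oplus, comps_cls, comps_cls, comps_cls, components_oplus]

theorem comps_zero : (0 : IsoClass).comps = 0 := by
  rw [← cls_empty, comps_cls, components_eq_zero_iff]

theorem comps_injective : Function.Injective IsoClass.comps := by
  intro x y h
  obtain ⟨F, rfl⟩ := exists_cls x
  obtain ⟨G, rfl⟩ := exists_cls y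
  rw [comps_cls, comps_cls] at h
  exact cls_eq_of_components_eq h

theorem card_comps_cls (F : LabeledForest) : F.cls.comps.card = F.roots.card := by
  rw [comps_cls, card_components]

/-- Classes of trees. -/
def IsoClass.IsTree (x : IsoClass) : Prop := ∃ T : LabeledForest, T.IsTree ∧ T.cls = x

theorem IsoClass.IsTree.comps_eq {x : IsoClass} (h : x.IsTree) : x.comps = {x} := by
  obtain ⟨T, hT, rfl⟩ := h
  rw [comps_cls, components_eq_of_isTree hT]

theorem isTree_of_mem_comps {x y : IsoClass} (h : y ∈ x.comps) : y.IsTree :=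
  exists_isTree_of_mem_components h

theorem comps_sum {s : Multiset IsoClass} (hs : ∀ x ∈ s, x.IsTree) : s.sum.comps = s := by
  induction s using Multiset.induction with
  | empty => exact comps_zero
  | cons a s ih =>
    rw [Multiset.sum_cons, comps_add, ih fun x hx => hs x (Multiset.mem_cons_of_mem hx),
      (hs a (Multiset.mem_cons_self a s)).comps_eq, Multiset.singleton_add]

/-- With `comps_add` and `comps_sum`, this identifies the monoid of classes with the finite
multisets of trees. -/
theorem sum_comps (x : IsoClass) : x.comps.sum = x :=
  comps_injective (comps_sum fun _ => isTree_of_mem_comps)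

theorem isTree_iff_card_comps {x : IsoClass} : x.IsTree ↔ x.comps.card = 1 := by
  constructor
  · intro h
    rw [h.comps_eq, Multiset.card_singleton]
  · intro h
    obtain ⟨y, hy⟩ := Multiset.card_eq_one.1 h
    have hy' : y ∈ x.comps := by simp [hy]
    rw [← sum_comps x, hy, Multiset.sum_singleton]
    exact isTree_of_mem_comps hy'

theorem cls_isTree_iff {F : LabeledForest} : F.cls.IsTree ↔ F.IsTree := by
  rw [isTree_iff_card_comps, card_comps_cls, isTree_iff, Finset.card_eq_one]

theorem comps_eq_zero_iff {x : IsoClass} : x.comps = 0 ↔ x = 0 := by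
  rw [← comps_zero, comps_injective.eq_iff]

/-! ### Finiteness in each size, and additivity of the size under cuts -/

theorem finite_lab_subset (n : ℕ) : {F : LabeledForest | F.lab ⊆ Finset.range n}.Finite := by
  classical
  -- A forest is determined by its label set and its set of edges, both finite.
  let f : LabeledForest → Finset ℕ × Finset (ℕ × ℕ) := fun F =>
    (F.lab, (F.lab ×ˢ F.lab).filter fun p => F.parent p.1 = some p.2)
  have hf : Function.Injective f := by
    intro F G h
    have h1 : F.lab = G.lab := congrArg Prod.fst h
    refine ext_rel h1 fun v w => ?_
    have h2 := congrArg (fun p => (v, w) ∈ p.2) h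
    simp only [f, Finset.mem_filter, Finset.mem_product, eq_iff_iff] at h2
    exact ⟨fun hv => (h2.1 ⟨F.parent_mem v w hv, hv⟩).2,
      fun hv => (h2.2 ⟨G.parent_mem v w hv, hv⟩).2⟩
  refine Set.Finite.of_finite_image (f := f) (Set.Finite.subset
    ((Finset.range n).powerset ×ˢ (Finset.range n ×ˢ Finset.range n).powerset).finite_toSet ?_)
    hf.injOn
  rintro _ ⟨F, hF, rfl⟩
  rw [Finset.mem_coe, Finset.mem_product, Finset.mem_powerset, Finset.mem_powerset]
  exact ⟨hF, (Finset.filter_subset _ _).trans (Finset.product_subset_product hF hF)⟩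

theorem exists_lab_eq_range (F : LabeledForest) :
    ∃ G : LabeledForest, G.cls = F.cls ∧ G.lab = Finset.range F.lab.card := by
  have hinf : ∀ s : Finset ℕ, Infinite {x // ¬ x ∈ s} := fun s =>
    (s.finite_toSet.infinite_compl).to_subtype
  have := hinf F.lab
  have := hinf (Finset.range F.lab.card)
  obtain ⟨ρ⟩ := nonempty_equiv_of_countable (α := {x // ¬ x ∈ F.lab})
    (β := {x // ¬ x ∈ Finset.range F.lab.card})
  let σ : {x // x ∈ F.lab} ≃ {x // x ∈ Finset.range F.lab.card} :=
    Finset.equivOfCardEq (by simp)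
  set τ : Equiv.Perm ℕ := Equiv.subtypeCongr σ ρ with hτ
  refine ⟨F.relabel τ.toEmbedding, cls_relabel _ _, ?_⟩
  refine Finset.eq_of_subset_of_card_le (fun x hx => ?_) (by simp)
  obtain ⟨v, hv, rfl⟩ := Finset.mem_map.1 hx
  have : τ v = σ ⟨v, hv⟩ := by
    rw [hτ]
    simp [Equiv.subtypeCongr, hv]
  rw [Equiv.coe_toEmbedding, this]
  exact (σ ⟨v, hv⟩).2

/-- Each class has a representative labelled by an initial segment of ℕ. A function has finite
support as soon as it vanishes on large forests, which is how products and coproducts are seen to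
stay in the Hall algebra. -/
theorem finite_size_le (n : ℕ) : {x : IsoClass | x.size ≤ n}.Finite := by
  refine ((finite_lab_subset n).image cls).subset fun x hx => ?_
  obtain ⟨F, rfl⟩ := exists_cls x
  obtain ⟨G, hG, hlab⟩ := exists_lab_eq_range F
  rw [Set.mem_ofPred_eq, size_cls] at hx
  refine ⟨G, ?_, hG⟩
  rw [Set.mem_ofPred_eq, hlab]
  exact Finset.range_subset_range.2 hx

theorem size_restrict_add_size_quot {F : LabeledForest} {S : Finset ℕ} (hS : S ∈ F.subforests) :
    (F.restrict S).cls.size + (F.quot S).cls.size = F.cls.size := by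
  have h := (mem_subforests.1 hS).1
  rw [size_cls, size_cls, size_cls, restrict_lab, quot, restrict_lab, Finset.inter_eq_right.2 h,
    Finset.inter_eq_right.2 Finset.sdiff_subset, add_comm, Finset.card_sdiff_add_card_eq_card h]

end LabeledForest

/-! ### The Ringel–Hall bialgebra -/

namespace Hall

open LabeledForest

noncomputable scoped instance instAddCommGroup : AddCommGroup Hall :=
  inferInstanceAs (AddCommGroup (IsoClass →₀ ℚ))

noncomputable scoped instance : Module ℚ Hall :=
  inferInstanceAs (Module ℚ (IsoClass →₀ ℚ))

/-- The basis of characteristic functions. -/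
noncomputable def basis : Module.Basis IsoClass ℚ Hall :=
  .ofRepr (LinearEquiv.refl ℚ (IsoClass →₀ ℚ))

/-- Evaluation at an isomorphism class. -/
noncomputable def ev (x : IsoClass) : Hall →ₗ[ℚ] ℚ := basis.coord x

theorem ev_eq_val (f : Hall) (F : LabeledForest) : ev F.cls f = f.val F := rfl

theorem ext_ev {f g : Hall} (h : ∀ x, ev x f = ev x g) : f = g := basis.ext_elem h

open scoped Classical in
theorem ev_basis (x y : IsoClass) : ev x (basis y) = if y = x then 1 else 0 := by
  rw [ev, Module.Basis.coord_apply, Module.Basis.repr_self, Finsupp.single_apply]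

/-- A finitely supported function as an element of the Hall algebra. -/
noncomputable def ofFun (φ : IsoClass → ℚ) (h : (Function.support φ).Finite) : Hall :=
  basis.repr.symm (Finsupp.ofSupportFinite φ h)

theorem ev_ofFun (φ : IsoClass → ℚ) (h : (Function.support φ).Finite) (x : IsoClass) :
    ev x (ofFun φ h) = φ x := by
  simp [ev, ofFun, Finsupp.ofSupportFinite_coe]

theorem finite_support_ev (f : Hall) : {x | ev x f ≠ 0}.Finite := by
  refine (basis.repr f).hasFiniteSupport.subset fun x hx => hx

theorem exists_size_le (f : Hall) : ∃ n, ∀ x, ev x f ≠ 0 → x.size ≤ n := by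
  obtain ⟨n, hn⟩ := ((finite_support_ev f).image IsoClass.size).bddAbove
  exact ⟨n, fun x hx => hn ⟨x, hx, rfl⟩⟩

/-- The value at a forest of the convolution product. -/
noncomputable def conv (f g : Hall) (F : LabeledForest) : ℚ :=
  ∑ S ∈ F.subforests, ev (F.restrict S).cls f * ev (F.quot S).cls g

theorem conv_eq_of_cls_eq (f g : Hall) {F G : LabeledForest} (h : F.cls = G.cls) :
    conv f g F = conv f g G := by
  obtain ⟨τ, rfl⟩ := cls_eq_iff.1 h
  exact (sum_subforests_relabel F τ fun x y => ev x f * ev y g).symm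

/-- Cutting splits the vertices into two disjoint parts, so bounds `m` and `n` on the sizes in the
two supports add up. -/
theorem finite_support_conv (f g : Hall) :
    (Function.support fun x : IsoClass => conv f g x.out).Finite := by
  obtain ⟨m, hm⟩ := exists_size_le f
  obtain ⟨n, hn⟩ := exists_size_le g
  refine (finite_size_le (m + n)).subset fun x hx => ?_
  obtain ⟨S, hS, h⟩ := Finset.exists_ne_zero_of_sum_ne_zero hx
  have h1 := hm _ (left_ne_zero_of_mul h)
  have h2 := hn _ (right_ne_zero_of_mul h)
  rw [Set.mem_ofPred_eq, ← cls_out x, ← size_restrict_add_size_quot hS]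
  omega

noncomputable scoped instance : Mul Hall :=
  ⟨fun f g => ofFun (fun x => conv f g x.out) (finite_support_conv f g)⟩

noncomputable scoped instance : One Hall := ⟨basis 0⟩

theorem ev_mul (f g : Hall) (F : LabeledForest) :
    ev F.cls (f * g) =
      ∑ S ∈ F.subforests, ev (F.restrict S).cls f * ev (F.quot S).cls g :=
  (ev_ofFun _ _ _).trans (conv_eq_of_cls_eq f g (cls_out _))

open scoped Classical in
theorem ev_one (x : IsoClass) : ev x (1 : Hall) = if x = 0 then 1 else 0 := by
  rw [show (1 : Hall) = basis 0 from rfl, ev_basis]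
  simp only [eq_comm]

theorem cls_restrict_eq_zero_iff {F : LabeledForest} {S : Finset ℕ} (hS : S ⊆ F.lab) :
    (F.restrict S).cls = 0 ↔ S = ∅ := by
  rw [← size_eq_zero, size_cls, restrict_lab, Finset.inter_eq_right.2 hS, Finset.card_eq_zero]

theorem empty_mem_subforests (F : LabeledForest) : ∅ ∈ F.subforests := by
  simp [mem_subforests]

theorem lab_mem_subforests (F : LabeledForest) : F.lab ∈ F.subforests := by
  rw [mem_subforests]
  exact ⟨subset_rfl, fun v w h _ => (F.parent_mem v w h).1⟩

theorem quot_empty (F : LabeledForest) : F.quot ∅ = F := by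
  rw [quot, Finset.sdiff_empty, restrict_self]

theorem one_mul_hall (f : Hall) : 1 * f = f := by
  refine ext_ev fun x => ?_
  obtain ⟨F, rfl⟩ := exists_cls x
  rw [ev_mul, Finset.sum_eq_single_of_mem ∅ (empty_mem_subforests F)]
  · rw [ev_one, if_pos ((cls_restrict_eq_zero_iff (Finset.empty_subset _)).2 rfl), one_mul,
      quot_empty]
  · intro S hS h
    rw [ev_one, if_neg fun h' => h ((cls_restrict_eq_zero_iff (mem_subforests.1 hS).1).1 h'),
      zero_mul]

theorem mul_one_hall (f : Hall) : f * 1 = f := by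
  refine ext_ev fun x => ?_
  obtain ⟨F, rfl⟩ := exists_cls x
  rw [ev_mul, Finset.sum_eq_single_of_mem F.lab (lab_mem_subforests F)]
  · rw [ev_one, quot, if_pos ((cls_restrict_eq_zero_iff Finset.sdiff_subset).2
        (Finset.sdiff_self _)),
      mul_one, restrict_self]
  · intro S hS h
    rw [ev_one, if_neg fun h' => h ?_, mul_zero]
    have := (cls_restrict_eq_zero_iff Finset.sdiff_subset).1 h'
    exact (mem_subforests.1 hS).1.antisymm (Finset.sdiff_eq_empty_iff_subset.1 this)

/-- Subforests of a subforest, and subforests of the quotient by a subforest, are both chains of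
two subforests. -/
theorem sum_chains {M : Type*} [AddCommMonoid M] (F : LabeledForest)
    (φ : LabeledForest → LabeledForest → LabeledForest → M) :
    ∑ S ∈ F.subforests, ∑ R ∈ (F.restrict S).subforests,
        φ ((F.restrict S).restrict R) ((F.restrict S).quot R) (F.quot S) =
      ∑ R ∈ F.subforests, ∑ Q ∈ (F.quot R).subforests,
        φ (F.restrict R) ((F.quot R).restrict Q) ((F.quot R).quot Q) := by
  rw [Finset.sum_sigma', Finset.sum_sigma']
  -- A chain R ⊆ S is recorded on the left as (S, R) and on the right as (R, Q) with Q = S \ R, so S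
  -- = R ∪ Q. In both cases the three pieces are R, S \ R and the complement of S.
  refine Finset.sum_bij' (fun p _ => ⟨p.2, p.1 \ p.2⟩) (fun p _ => ⟨p.1 ∪ p.2, p.1⟩) ?_ ?_ ?_ ?_ ?_
  · rintro ⟨S, R⟩ h
    simp only [Finset.mem_sigma, mem_subforests, restrict_lab, restrict_parent_iff, quot,
      Finset.subset_iff, Finset.mem_inter, Finset.mem_sdiff] at h ⊢
    obtain ⟨⟨h1, h2⟩, h3, h4⟩ := h
    refine ⟨⟨fun v hv => (h3 hv).1, fun v w hvw hw => ?_⟩, fun v hv => ⟨h1 hv.1, h1 hv.1, hv.2⟩, ?_⟩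
    · exact h4 v w ⟨h2 v w hvw (h3 hw).2, (h3 hw).2, hvw⟩ hw
    · rintro v w ⟨h5, h6, h7⟩ h8
      exact ⟨h2 v w h7 h8.1, h5.2⟩
  · rintro ⟨R, Q⟩ h
    simp only [Finset.mem_sigma, mem_subforests, restrict_lab, restrict_parent_iff, quot,
      Finset.subset_iff, Finset.mem_inter, Finset.mem_sdiff, Finset.mem_union] at h ⊢
    obtain ⟨⟨h1, h2⟩, h3, h4⟩ := h
    refine ⟨⟨fun v hv => hv.elim (fun hv => h1 hv) fun hv => (h3 hv).1, fun v w hvw hw => ?_⟩,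
      fun v hv => ⟨h1 hv, Or.inl hv⟩, fun v w hvw hw => h2 v w hvw.2.2 hw⟩
    by_cases hv : v ∈ R
    · exact Or.inl hv
    · rcases hw with hw | hw
      · exact Or.inl (h2 v w hvw hw)
      · exact Or.inr (h4 v w ⟨⟨(F.parent_mem v w hvw).1, hv⟩, (h3 hw).2, hvw⟩ hw)
  · rintro ⟨S, R⟩ h
    simp only [Finset.mem_sigma, mem_subforests, restrict_lab] at h
    have : R ⊆ S := h.2.1.trans Finset.inter_subset_right
    simp only [Finset.union_sdiff_of_subset this]
  · rintro ⟨R, Q⟩ h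
    simp only [Finset.mem_sigma, mem_subforests, restrict_lab, quot] at h
    have : Disjoint R Q :=
      (Finset.disjoint_sdiff.mono_right (h.2.1.trans Finset.inter_subset_right))
    simp only [Finset.union_sdiff_cancel_left this]
  · rintro ⟨S, R⟩ h
    simp only [Finset.mem_sigma, mem_subforests, restrict_lab] at h
    have hRS : R ⊆ S := h.2.1.trans Finset.inter_subset_right
    have hSF := h.1.1
    simp only [quot, restrict_restrict, restrict_lab]
    congr 1
    · rw [Finset.inter_eq_right.2 hRS]
    · refine restrict_eq_of_inter_eq _ ?_
      ext v
      simp only [Finset.mem_inter, Finset.mem_sdiff]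
      tauto
    · refine restrict_eq_of_inter_eq _ ?_
      ext v
      have := @hRS v
      simp only [Finset.mem_inter, Finset.mem_sdiff]
      tauto

theorem mul_assoc_hall (f g h : Hall) : f * g * h = f * (g * h) := by
  refine ext_ev fun x => ?_
  obtain ⟨F, rfl⟩ := exists_cls x
  simp only [ev_mul, Finset.sum_mul, Finset.mul_sum, mul_assoc]
  exact sum_chains F fun A B C => ev A.cls f * (ev B.cls g * ev C.cls h)

theorem add_mul_hall (f g h : Hall) : (f + g) * h = f * h + g * h := by
  refine ext_ev fun x => ?_
  obtain ⟨F, rfl⟩ := exists_cls x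
  simp only [ev_mul, map_add, add_mul, Finset.sum_add_distrib]

theorem mul_add_hall (f g h : Hall) : f * (g + h) = f * g + f * h := by
  refine ext_ev fun x => ?_
  obtain ⟨F, rfl⟩ := exists_cls x
  simp only [ev_mul, map_add, mul_add, Finset.sum_add_distrib]

theorem smul_mul_hall (c : ℚ) (f g : Hall) : c • f * g = c • (f * g) := by
  refine ext_ev fun x => ?_
  obtain ⟨F, rfl⟩ := exists_cls x
  simp only [ev_mul, map_smul, smul_eq_mul, Finset.mul_sum, mul_assoc]

theorem mul_smul_hall (c : ℚ) (f g : Hall) : f * c • g = c • (f * g) := by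
  refine ext_ev fun x => ?_
  obtain ⟨F, rfl⟩ := exists_cls x
  simp only [ev_mul, map_smul, smul_eq_mul, Finset.mul_sum, mul_left_comm]

theorem zero_mul_hall (f : Hall) : 0 * f = 0 := by
  simpa using smul_mul_hall 0 0 f

theorem mul_zero_hall (f : Hall) : f * 0 = 0 := by
  simpa using mul_smul_hall 0 f 0

noncomputable scoped instance instRing : Ring Hall where
  __ := instAddCommGroup
  left_distrib := mul_add_hall
  right_distrib := add_mul_hall
  zero_mul := zero_mul_hall
  mul_zero := mul_zero_hall
  mul_assoc := mul_assoc_hall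
  one_mul := one_mul_hall
  mul_one := mul_one_hall

noncomputable scoped instance : Algebra ℚ Hall := Algebra.ofModule smul_mul_hall mul_smul_hall

/-! ### The coproduct and its compatibility with the product -/

/-- Evaluation of a tensor at a pair of isomorphism classes. -/
noncomputable def ev₂ (x y : IsoClass) : Hall ⊗[ℚ] Hall →ₗ[ℚ] ℚ :=
  (basis.tensorProduct basis).coord (x, y)

theorem ev₂_tmul (x y : IsoClass) (f g : Hall) : ev₂ x y (f ⊗ₜ g) = ev x f * ev y g := by
  simp [ev₂, ev, mul_comm]

theorem ext_ev₂ {t u : Hall ⊗[ℚ] Hall} (h : ∀ x y, ev₂ x y t = ev₂ x y u) : t = u :=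
  (basis.tensorProduct basis).ext_elem fun p => h p.1 p.2

/-- Each summand is no larger than the sum, so a bound for the support of `f` bounds both
coordinates. -/
theorem finite_support_comul (f : Hall) :
    (Function.support fun p : IsoClass × IsoClass => ev (p.1 + p.2) f).Finite := by
  obtain ⟨n, hn⟩ := exists_size_le f
  refine ((finite_size_le n).prod (finite_size_le n)).subset fun p hp => ?_
  have := hn _ hp
  rw [size_add] at this
  exact ⟨by rw [Set.mem_ofPred_eq]; omega, by rw [Set.mem_ofPred_eq]; omega⟩

/-- The coproduct `Δ(f)(F, G) = f(F ⊕ G)`. -/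
noncomputable def comulHall : Hall →ₗ[ℚ] Hall ⊗[ℚ] Hall :=
  (basis.tensorProduct basis).repr.symm.toLinearMap ∘ₗ
    { toFun f := Finsupp.ofSupportFinite (fun p : IsoClass × IsoClass => ev (p.1 + p.2) f)
        (finite_support_comul f)
      map_add' f g := by ext p; simp [Finsupp.ofSupportFinite_coe]
      map_smul' c f := by ext p; simp [Finsupp.ofSupportFinite_coe] }

theorem ev₂_comulHall (x y : IsoClass) (f : Hall) : ev₂ x y (comulHall f) = ev (x + y) f := by
  simp [ev₂, comulHall, Finsupp.ofSupportFinite_coe]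

/-- Evaluation of a tensor at a triple of isomorphism classes. -/
noncomputable def ev₃ (x y z : IsoClass) : Hall ⊗[ℚ] (Hall ⊗[ℚ] Hall) →ₗ[ℚ] ℚ :=
  (basis.tensorProduct (basis.tensorProduct basis)).coord (x, y, z)

theorem ev₃_tmul (x y z : IsoClass) (f : Hall) (t : Hall ⊗[ℚ] Hall) :
    ev₃ x y z (f ⊗ₜ t) = ev x f * ev₂ y z t := by
  simp [ev₃, ev₂, ev, mul_comm]

theorem ev₃_assoc (x y z : IsoClass) (t : Hall ⊗[ℚ] Hall) (f : Hall) :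
    ev₃ x y z (TensorProduct.assoc ℚ Hall Hall Hall (t ⊗ₜ f)) = ev₂ x y t * ev z f := by
  induction t with
  | zero => simp
  | add t u ht hu => simp only [TensorProduct.add_tmul, map_add, ht, hu, add_mul]
  | tmul a b => rw [TensorProduct.assoc_tmul, ev₃_tmul, ev₂_tmul, ev₂_tmul, mul_assoc]

-- The coproduct is dual to addition of classes. Tested against evaluations, coassociativity is
-- `add_assoc` and the counit laws are `zero_add` and `add_zero`.
noncomputable scoped instance : Coalgebra ℚ Hall where
  comul := comulHall
  counit := ev 0
  coassoc := by
    refine LinearMap.ext fun f => (basis.tensorProduct (basis.tensorProduct basis)).ext_elem ?_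
    rintro ⟨x, y, z⟩
    have h1 : ∀ t, ev₃ x y z (TensorProduct.assoc ℚ Hall Hall Hall (comulHall.rTensor Hall t)) =
        ev₂ (x + y) z t := by
      intro t
      induction t with
      | zero => simp
      | add t u ht hu => simp only [map_add, ht, hu]
      | tmul a b => rw [LinearMap.rTensor_tmul, ev₃_assoc, ev₂_comulHall, ev₂_tmul]
    have h2 : ∀ t, ev₃ x y z (comulHall.lTensor Hall t) = ev₂ x (y + z) t := by
      intro t
      induction t with
      | zero => simp
      | add t u ht hu => simp only [map_add, ht, hu]
      | tmul a b => rw [LinearMap.lTensor_tmul, ev₃_tmul, ev₂_comulHall, ev₂_tmul]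
    refine (h1 _).trans (Eq.trans ?_ (h2 _).symm)
    rw [ev₂_comulHall, ev₂_comulHall, add_assoc]
  rTensor_counit_comp_comul := by
    refine LinearMap.ext fun f => (TensorProduct.lid ℚ Hall).injective (ext_ev fun y => ?_)
    have h : ∀ t, ev y (TensorProduct.lid ℚ Hall ((ev 0).rTensor Hall t)) = ev₂ 0 y t := by
      intro t
      induction t with
      | zero => simp
      | add t u ht hu => simp only [map_add, ht, hu]
      | tmul a b => simp [ev₂_tmul]
    refine (h _).trans ?_
    rw [ev₂_comulHall, zero_add]
    simp
  lTensor_counit_comp_comul := by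
    refine LinearMap.ext fun f => (TensorProduct.rid ℚ Hall).injective (ext_ev fun y => ?_)
    have h : ∀ t, ev y (TensorProduct.rid ℚ Hall ((ev 0).lTensor Hall t)) = ev₂ y 0 t := by
      intro t
      induction t with
      | zero => simp
      | add t u ht hu => simp only [map_add, ht, hu]
      | tmul a b => simp [ev₂_tmul, mul_comm]
    refine (h _).trans ?_
    rw [ev₂_comulHall, add_zero]
    simp

theorem ev₂_comul (x y : IsoClass) (f : Hall) :
    ev₂ x y (Coalgebra.comul (R := ℚ) f) = ev (x + y) f := ev₂_comulHall x y f

theorem counit_eq (f : Hall) : Coalgebra.counit (R := ℚ) f = ev 0 f := rfl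

theorem ev₂_mul (t u : Hall ⊗[ℚ] Hall) (F G : LabeledForest) :
    ev₂ F.cls G.cls (t * u) = ∑ S ∈ F.subforests, ∑ T ∈ G.subforests,
      ev₂ (F.restrict S).cls (G.restrict T).cls t * ev₂ (F.quot S).cls (G.quot T).cls u := by
  induction t with
  | zero => simp
  | add t t' ht ht' => simp only [map_add, add_mul, ht, ht', Finset.sum_add_distrib]
  | tmul a b =>
    induction u with
    | zero => simp
    | add u u' hu hu' => simp only [map_add, mul_add, hu, hu', Finset.sum_add_distrib]
    | tmul c d =>
      simp only [Algebra.TensorProduct.tmul_mul_tmul, ev₂_tmul, ev_mul, Finset.sum_mul_sum]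
      refine Finset.sum_congr rfl fun S _ => Finset.sum_congr rfl fun T _ => ?_
      ring

/-- A subforest of a disjoint union is a pair of subforests, and restriction and quotient are taken
componentwise, so the two double sums agree term by term. -/
theorem comul_mul (f g : Hall) : Coalgebra.comul (R := ℚ) (f * g) =
    Coalgebra.comul (R := ℚ) f * Coalgebra.comul (R := ℚ) g := by
  refine ext_ev₂ fun x y => ?_
  obtain ⟨F, rfl⟩ := exists_cls x
  obtain ⟨G, rfl⟩ := exists_cls y
  rw [ev₂_mul, ev₂_comul, ← cls_oplus, ev_mul, sum_subforests_oplus]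
  simp only [ev₂_comul, oplus_restrict, oplus_quot, cls_oplus]

theorem add_eq_zero_iff {x y : IsoClass} : x + y = 0 ↔ x = 0 ∧ y = 0 := by
  rw [← size_eq_zero, size_add, Nat.add_eq_zero_iff, size_eq_zero, size_eq_zero]

theorem comul_one : Coalgebra.comul (R := ℚ) (1 : Hall) = 1 := by
  refine ext_ev₂ fun x y => ?_
  rw [ev₂_comul, Algebra.TensorProduct.one_def, ev₂_tmul, ev_one, ev_one, ev_one]
  by_cases hx : x = 0 <;> by_cases hy : y = 0 <;> simp [add_eq_zero_iff, hx, hy]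

/-- The empty forest has only the empty subforest, so the convolution sum there has a single term.
-/
theorem counit_mul (f g : Hall) : Coalgebra.counit (R := ℚ) (f * g) =
    Coalgebra.counit (R := ℚ) f * Coalgebra.counit (R := ℚ) g := by
  have h : empty.subforests = {∅} := by
    ext S
    rw [mem_subforests, Finset.mem_singleton]
    constructor
    · exact fun h => Finset.subset_empty.1 h.1
    · rintro rfl
      exact ⟨Finset.empty_subset _, by simp⟩
  rw [counit_eq, counit_eq, counit_eq, ← cls_empty, ev_mul, h, Finset.sum_singleton, quot_empty,
    restrict_empty]

noncomputable scoped instance : Bialgebra ℚ Hall :=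
  .mk' ℚ Hall (by rw [counit_eq, ev_one, if_pos rfl]) (counit_mul _ _) comul_one (comul_mul _ _)

scoped instance instIsCocomm : Coalgebra.IsCocomm ℚ Hall where
  comm_comp_comul := by
    refine LinearMap.ext fun f => ext_ev₂ fun x y => ?_
    have h : ∀ t, ev₂ x y (TensorProduct.comm ℚ Hall Hall t) = ev₂ y x t := by
      intro t
      induction t with
      | zero => simp
      | add t u ht hu => simp only [map_add, ht, hu]
      | tmul a b => rw [TensorProduct.comm_tmul, ev₂_tmul, ev₂_tmul, mul_comm]
    refine (h _).trans ?_
    rw [ev₂_comul, ev₂_comul, add_comm]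

end Hall

/-! ### Primitive elements and the Lie algebra on rooted trees -/

namespace Hall

open LabeledForest

/-- The property of being primitive. -/
def IsPrim (f : Hall) : Prop := Coalgebra.comul (R := ℚ) f = f ⊗ₜ[ℚ] 1 + 1 ⊗ₜ[ℚ] f

theorem mem_span_basis_iff {f : Hall} {s : Set IsoClass} :
    f ∈ Submodule.span ℚ (basis '' s) ↔ ∀ x, ev x f ≠ 0 → x ∈ s := by
  rw [Module.Basis.mem_span_image]
  exact ⟨fun h x hx => h (Finsupp.mem_support_iff.2 hx),
    fun h x hx => h x (Finsupp.mem_support_iff.1 hx)⟩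

theorem exists_add_of_not_isTree {x : IsoClass} (hx : ¬ x.IsTree) (hx' : x ≠ 0) :
    ∃ y z, y ≠ 0 ∧ z ≠ 0 ∧ x = y + z := by
  obtain ⟨a, ha⟩ := Multiset.exists_mem_of_ne_zero (comps_eq_zero_iff.not.2 hx')
  obtain ⟨s, hs⟩ := Multiset.exists_cons_of_mem ha
  have hsum : x = a + s.sum := by rw [← sum_comps x, hs, Multiset.sum_cons]
  have ha' := (isTree_of_mem_comps ha).comps_eq
  refine ⟨a, s.sum, ?_, ?_, hsum⟩
  · rintro rfl
    rw [comps_zero] at ha'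
    simpa using congrArg Multiset.card ha'
  · intro h
    rw [h, add_zero] at hsum
    exact hx (hsum ▸ isTree_of_mem_comps ha)

theorem IsTree.ne_zero {x : IsoClass} (hx : x.IsTree) : x ≠ 0 := by
  rintro rfl
  rw [isTree_iff_card_comps, comps_zero] at hx
  simp at hx

theorem not_isTree_add {x y : IsoClass} (hx : x ≠ 0) (hy : y ≠ 0) : ¬ (x + y).IsTree := by
  rw [isTree_iff_card_comps, comps_add, Multiset.card_add]
  have h1 := Multiset.card_pos.2 (comps_eq_zero_iff.not.2 hx)
  have h2 := Multiset.card_pos.2 (comps_eq_zero_iff.not.2 hy)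
  omega

/-- Evaluated at (y, z), primitivity reads f(y + z) = f(y)1(z) + 1(y)f(z). At (0, 0) this gives f(0)
= 2f(0), so f(0) = 0; for nonzero y and z it gives f(y + z) = 0. The nonzero classes that are not
such sums are exactly the trees. -/
theorem isPrim_iff {f : Hall} :
    IsPrim f ↔ f ∈ Submodule.span ℚ (basis '' {x | x.IsTree}) := by
  rw [mem_span_basis_iff]
  constructor
  · intro h x hx
    have key : ∀ y z, ev (y + z) f = ev y f * ev z 1 + ev y 1 * ev z f := by
      intro y z
      rw [← ev₂_comul, h, map_add, ev₂_tmul, ev₂_tmul]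
    by_contra hT
    by_cases hx' : x = 0
    · subst hx'
      have := key 0 0
      rw [ev_one, if_pos rfl, add_zero] at this
      exact hx (by linarith)
    · obtain ⟨y, z, hy, hz, rfl⟩ := exists_add_of_not_isTree hT hx'
      rw [key, ev_one, ev_one, if_neg hy, if_neg hz] at hx
      simp at hx
  · intro h
    refine ext_ev₂ fun x y => ?_
    rw [ev₂_comul, map_add, ev₂_tmul, ev₂_tmul, ev_one, ev_one]
    have h0 : ev 0 f = 0 := by
      by_contra h'
      exact IsTree.ne_zero (h 0 h') rfl
    by_cases hx : x = 0
    · subst hx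
      by_cases hy : y = 0
      · subst hy; simp [h0]
      · simp [hy]
    · by_cases hy : y = 0
      · subst hy; simp [hx]
      · simp only [hx, hy, if_false, mul_zero, zero_mul, add_zero]
        by_contra h'
        exact not_isTree_add hx hy (h _ h')

theorem IsPrim.commutator {f g : Hall} (hf : IsPrim f) (hg : IsPrim g) :
    IsPrim (f * g - g * f) := by
  unfold IsPrim at *
  rw [map_sub, comul_mul, comul_mul, hf, hg]
  simp only [add_mul, mul_add, Algebra.TensorProduct.tmul_mul_tmul, mul_one, one_mul,
    TensorProduct.sub_tmul, TensorProduct.tmul_sub]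
  abel

-- The bracket on rooted trees, pulled back from commutators

noncomputable scoped instance instAddCommGroupTreeLie : AddCommGroup TreeLie :=
  inferInstanceAs (AddCommGroup (UnlabeledTree →₀ ℚ))

noncomputable scoped instance : Module ℚ TreeLie :=
  inferInstanceAs (Module ℚ (UnlabeledTree →₀ ℚ))

/-- The basis of trees. -/
noncomputable def treeBasis : Module.Basis UnlabeledTree ℚ TreeLie :=
  .ofRepr (LinearEquiv.refl ℚ (UnlabeledTree →₀ ℚ))

/-- The inclusion of `𝔫_T` as a linear map. -/
noncomputable def incl : TreeLie →ₗ[ℚ] Hall where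
  toFun := ofTrees
  map_add' _ _ := Finsupp.mapDomain_add
  map_smul' _ _ := Finsupp.mapDomain_smul _ _

theorem incl_ofTree (t : UnlabeledTree) : incl (TreeLie.ofTree t) = basis t.1 :=
  Finsupp.mapDomain_single

theorem incl_injective : Function.Injective incl :=
  Finsupp.mapDomain_injective Subtype.val_injective

theorem ev_incl (x : TreeLie) (t : UnlabeledTree) : ev t.1 (incl x) = x.coeff t :=
  Finsupp.mapDomain_apply Subtype.val_injective _ _

theorem mem_range_incl {f : Hall} : f ∈ LinearMap.range incl ↔ IsPrim f := by
  rw [isPrim_iff]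
  suffices h : LinearMap.range incl = Submodule.span ℚ (basis '' {x | x.IsTree}) by rw [h]
  rw [LinearMap.range_eq_map, ← treeBasis.span_eq, Submodule.map_span]
  congr 1
  ext g
  constructor
  · rintro ⟨_, ⟨t, rfl⟩, rfl⟩
    exact ⟨t.1, t.2, (incl_ofTree t).symm⟩
  · rintro ⟨x, hx, rfl⟩
    exact ⟨_, ⟨⟨x, hx⟩, rfl⟩, incl_ofTree ⟨x, hx⟩⟩

theorem isPrim_incl (x : TreeLie) : IsPrim (incl x) := mem_range_incl.1 ⟨x, rfl⟩

/-- The image of `incl` is the space of primitive elements, which is closed under commutators. The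
bracket is defined as the preimage, unique by injectivity. -/
theorem exists_incl_eq_commutator (x y : TreeLie) :
    ∃ z, incl z = incl x * incl y - incl y * incl x :=
  mem_range_incl.2 ((isPrim_incl x).commutator (isPrim_incl y))

noncomputable scoped instance : Bracket TreeLie TreeLie :=
  ⟨fun x y => (exists_incl_eq_commutator x y).choose⟩

theorem incl_bracket (x y : TreeLie) :
    incl ⁅x, y⁆ = incl x * incl y - incl y * incl x :=
  (exists_incl_eq_commutator x y).choose_spec

-- After applying the injective map `incl`, the Lie identities become those of commutators in an
-- associative ring, so no identity between graft counts is needed.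
noncomputable scoped instance instLieRing : LieRing TreeLie where
  add_lie x y z := incl_injective <| by
    simp only [incl_bracket, map_add, add_mul, mul_add]
    abel
  lie_add x y z := incl_injective <| by
    simp only [incl_bracket, map_add, add_mul, mul_add]
    abel
  lie_self x := incl_injective <| by simp only [incl_bracket, sub_self, map_zero]
  leibniz_lie x y z := incl_injective <| by
    simp only [incl_bracket, map_add, sub_mul, mul_sub, mul_assoc]
    abel

noncomputable scoped instance instLieAlgebra : LieAlgebra ℚ TreeLie where
  lie_smul c x y := incl_injective <| by
    simp only [incl_bracket, map_smul, smul_sub, smul_mul_assoc, mul_smul_comm]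

/-- A subforest with a single root is the whole branch at that root: closure under children gives
one inclusion, and following parents inside `S` up to a root gives the other. -/
theorem below_of_roots_restrict {T : LabeledForest} {S : Finset ℕ} (hS : S ∈ T.subforests) {r : ℕ}
    (hr : (T.restrict S).roots = {r}) : T.prunedLab {r} = S := by
  rw [mem_subforests] at hS
  have hrS : r ∈ S := by
    have h : r ∈ (T.restrict S).roots := by simp [hr]
    rw [mem_roots, restrict_lab, Finset.mem_inter] at h
    exact h.1.2
  ext v
  rw [mem_prunedLab_singleton]
  constructor
  · rintro ⟨-, h⟩
    induction h using Relation.ReflTransGen.head_induction_on with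
    | refl => exact hrS
    | head h _ ih => exact hS.2 _ _ h ih
  · intro hv
    refine ⟨hS.1 hv, ?_⟩
    have hv' : v ∈ (T.restrict S).lab := Finset.mem_inter.2 ⟨hS.1 hv, hv⟩
    obtain ⟨s, hs, hvs⟩ := exists_root_above hv'
    rw [hr, Finset.mem_singleton] at hs
    subst hs
    exact Relation.ReflTransGen.mono (fun a b hab => ((restrict_parent_iff _ _ _ _).1 hab).2.2)
      _ _ hvs

/-- The structure constants of the product of two trees at a tree. -/
theorem ev_basis_mul_basis (t₁ t₂ : UnlabeledTree) (T : LabeledForest) (hT : T.IsTree) :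
    ev T.cls (basis t₁.1 * basis t₂.1) = T.graftCount t₁ t₂ := by
  classical
  have : ev T.cls (basis t₁.1 * basis t₂.1) =
      ((T.subforests.filter fun S =>
        t₁.1 = (T.restrict S).cls ∧ t₂.1 = (T.quot S).cls).card : ℚ) := by
    rw [ev_mul, Finset.card_filter, Nat.cast_sum]
    refine Finset.sum_congr rfl fun S _ => ?_
    rw [ev_basis, ev_basis, ite_zero_mul_ite_zero, mul_one]
    push_cast
    rfl
  rw [this, graftCount, Nat.cast_inj]
  symm
  refine Finset.card_bij (fun v _ => T.prunedLab {v}) ?_ ?_ ?_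
  · intro v hv
    rw [Finset.mem_filter] at hv ⊢
    exact ⟨prunedLab_mem_subforests, hv.2.2.1.symm, hv.2.2.2.symm⟩
  · intro v hv w hw h
    rw [Finset.mem_filter] at hv hw
    have h1 : v ∈ T.prunedLab {w} := by
      rw [← h, mem_prunedLab_singleton]; exact ⟨hv.1, .refl⟩
    have h2 : w ∈ T.prunedLab {v} := by
      rw [h, mem_prunedLab_singleton]; exact ⟨hw.1, .refl⟩
    exact below_antisymm (mem_prunedLab_singleton.1 h1).2 (mem_prunedLab_singleton.1 h2).2
  · intro S hS
    rw [Finset.mem_filter] at hS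
    obtain ⟨hS, h1, h2⟩ := hS
    have hS1 : (T.restrict S).IsTree := by
      rw [← cls_isTree_iff, ← h1]; exact t₁.2
    obtain ⟨r, hr⟩ := isTree_iff.1 hS1
    have hrS := below_of_roots_restrict hS hr
    have hr' : r ∈ T.lab := by
      have h : r ∈ (T.restrict S).roots := by simp [hr]
      rw [mem_roots, restrict_lab, Finset.mem_inter] at h
      exact h.1.1
    refine ⟨r, ?_, hrS⟩
    rw [Finset.mem_filter]
    subst hrS
    refine ⟨hr', ?_, h1.symm, h2.symm⟩
    -- Without a parent, `r` would be the root of `T`. The branch would then be all of `T` and the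
    -- quotient empty, whereas `t₂` is a tree and hence nonempty.
    by_contra hpar
    have hpar' : T.parent r = none := by simpa using hpar
    obtain ⟨s, hs⟩ := isTree_iff.1 hT
    have : r ∈ T.roots := mem_roots.2 ⟨hr', hpar'⟩
    rw [hs, Finset.mem_singleton] at this
    subst this
    have hne := IsTree.ne_zero (show (T.quot (T.prunedLab {r})).cls.IsTree from h2 ▸ t₂.2)
    refine hne ((cls_restrict_eq_zero_iff Finset.sdiff_subset).2 ?_)
    have h := congrArg lab (pruned_eq_self hs)
    rw [pruned, restrict_lab, Finset.inter_eq_left] at h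
    exact Finset.sdiff_eq_empty_iff_subset.2 h

theorem isConnesKreimer : TreeLie.IsConnesKreimer where
  coeff_add _ _ _ := rfl
  coeff_smul _ _ _ := rfl
  coeff_bracket t₁ t₂ T hT := by
    refine (ev_incl _ ⟨T.cls, T, hT, rfl⟩).symm.trans ?_
    rw [incl_bracket, incl_ofTree, incl_ofTree, map_sub, ev_basis_mul_basis _ _ T hT,
      ev_basis_mul_basis _ _ T hT]

theorem mul'_map_ev (F G : LabeledForest) (f : Hall) :
    LinearMap.mul' ℚ ℚ (TensorProduct.map (ev F.cls) (ev G.cls) (Coalgebra.comul (R := ℚ) f)) =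
      f.val (F.oplus G) := by
  have h : ∀ t, LinearMap.mul' ℚ ℚ (TensorProduct.map (ev F.cls) (ev G.cls) t) =
      ev₂ F.cls G.cls t := by
    intro t
    induction t with
    | zero => simp
    | add t u ht hu => simp only [map_add, ht, hu]
    | tmul a b => rw [TensorProduct.map_tmul, LinearMap.mul'_apply, ev₂_tmul]
  rw [h, ev₂_comul, ← cls_oplus, ev_eq_val]

/-! ### The grading by the number of vertices -/

/-- The functions supported on the forests with `n` vertices. -/
noncomputable def homog (n : ℕ) : Submodule ℚ Hall := Submodule.span ℚ (basis '' {x | x.size = n})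

theorem mem_homog_iff {n : ℕ} {f : Hall} : f ∈ homog n ↔ ∀ x, ev x f ≠ 0 → x.size = n :=
  mem_span_basis_iff

theorem basis_mem_homog (x : IsoClass) : basis x ∈ homog x.size :=
  Submodule.subset_span ⟨x, rfl, rfl⟩

noncomputable scoped instance instDecomposition : DirectSum.Decomposition homog :=
  .ofLinearMap _ (basis.constr ℚ fun x =>
      DirectSum.lof ℚ ℕ (fun n => homog n) x.size ⟨basis x, basis_mem_homog x⟩)
    (basis.ext fun x => by simp)
    (DirectSum.linearMap_ext _ fun n => by
      refine LinearMap.ext fun ⟨f, hf⟩ => ?_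
      simp only [LinearMap.comp_apply, DirectSum.coeLinearMap_lof, LinearMap.id_apply]
      induction hf using Submodule.span_induction with
      | mem f hf =>
        obtain ⟨x, rfl, rfl⟩ := hf
        simp
      | zero => simp only [map_zero]; exact (map_zero _).symm
      | add f g hf hg hf' hg' =>
        rw [map_add, hf', hg', ← map_add]; rfl
      | smul c f hf hf' => rw [map_smul, hf', ← map_smul]; rfl)

scoped instance instGradedMonoid : SetLike.GradedMonoid homog where
  one_mem := by
    have := basis_mem_homog 0
    rwa [size_eq_zero.2 rfl] at this
  mul_mem m n f g hf hg := by
    rw [mem_homog_iff] at *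
    intro x hx
    obtain ⟨F, rfl⟩ := exists_cls x
    rw [ev_mul] at hx
    obtain ⟨S, hS, h⟩ := Finset.exists_ne_zero_of_sum_ne_zero hx
    rw [← size_restrict_add_size_quot hS, hf _ (left_ne_zero_of_mul h),
      hg _ (right_ne_zero_of_mul h)]

noncomputable scoped instance instGradedAlgebra : GradedAlgebra homog where

theorem mem_of_ev₂ {M : Submodule ℚ (Hall ⊗[ℚ] Hall)} {t : Hall ⊗[ℚ] Hall}
    (h : ∀ x y, ev₂ x y t ≠ 0 → basis x ⊗ₜ basis y ∈ M) : t ∈ M := by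
  rw [← (basis.tensorProduct basis).linearCombination_repr t, Finsupp.linearCombination_apply]
  refine Submodule.sum_mem _ fun p hp => Submodule.smul_mem _ _ ?_
  rw [Module.Basis.tensorProduct_apply']
  exact h p.1 p.2 (Finsupp.mem_support_iff.1 hp)

theorem comul_mem_homog {n : ℕ} {f : Hall} (hf : f ∈ homog n) :
    Coalgebra.comul (R := ℚ) f ∈ ⨆ p ∈ Finset.HasAntidiagonal.antidiagonal n,
      LinearMap.range (TensorProduct.map (homog p.1).subtype (homog p.2).subtype) := by
  refine mem_of_ev₂ fun x y hxy => ?_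
  rw [ev₂_comul] at hxy
  have h := mem_homog_iff.1 hf _ hxy
  rw [size_add] at h
  refine Submodule.mem_iSup_of_mem (x.size, y.size)
    (Submodule.mem_iSup_of_mem (Finset.HasAntidiagonal.mem_antidiagonal.2 h) ?_)
  exact ⟨⟨basis x, basis_mem_homog x⟩ ⊗ₜ ⟨basis y, basis_mem_homog y⟩, by simp⟩

theorem homog_zero : homog 0 = Submodule.span ℚ {(1 : Hall)} := by
  have : {x : IsoClass | x.size = 0} = {0} := by
    ext x
    exact size_eq_zero
  rw [homog, this, Set.image_singleton]
  rfl

/-! ### Degree as an eigenvalue -/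

/-- The linear map that multiplies functions of degree `n` by `2 ^ n`. -/
noncomputable def scaleLinear : Hall →ₗ[ℚ] Hall :=
  basis.constr ℚ fun x : IsoClass => (2 ^ x.size : ℚ) • basis x

theorem ev_scaleLinear (x : IsoClass) (f : Hall) : ev x (scaleLinear f) = 2 ^ x.size * ev x f := by
  classical
  have : ev x ∘ₗ scaleLinear = (2 ^ x.size : ℚ) • ev x := by
    refine basis.ext fun y => ?_
    simp only [scaleLinear, LinearMap.comp_apply, Module.Basis.constr_basis, map_smul, ev_basis,
      LinearMap.smul_apply]
    split_ifs with h <;> simp [h]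
  exact LinearMap.congr_fun this f

/-- The algebra automorphism that multiplies functions of degree `n` by `2 ^ n`. -/
noncomputable def scale : Hall →ₐ[ℚ] Hall :=
  AlgHom.ofLinearMap scaleLinear
    (by
      classical
      refine ext_ev fun x => ?_
      rw [ev_scaleLinear, ev_one]
      split_ifs with h
      · rw [size_eq_zero.2 h, pow_zero, one_mul]
      · rw [mul_zero])
    fun f g => by
      refine ext_ev fun x => ?_
      obtain ⟨F, rfl⟩ := exists_cls x
      rw [ev_scaleLinear, ev_mul, ev_mul, Finset.mul_sum]
      refine Finset.sum_congr rfl fun S hS => ?_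
      rw [ev_scaleLinear, ev_scaleLinear, ← size_restrict_add_size_quot hS, pow_add]
      ring

theorem ev_scale (x : IsoClass) (f : Hall) : ev x (scale f) = 2 ^ x.size * ev x f :=
  ev_scaleLinear x f

/-- The numbers 2^n are distinct, so the homogeneous parts are eigenspaces. A linear map that
commutes with `scale` therefore preserves the degree; this is how the antipode is handled. -/
theorem mem_homog_iff_scale {n : ℕ} {f : Hall} :
    f ∈ homog n ↔ scale f = (2 ^ n : ℚ) • f := by
  rw [mem_homog_iff]
  constructor
  · intro h
    refine ext_ev fun x => ?_
    rw [ev_scale, map_smul, smul_eq_mul]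
    by_cases hx : ev x f = 0
    · simp [hx]
    · rw [h x hx]
  · intro h x hx
    have := congrArg (ev x) h
    rw [ev_scale, map_smul, smul_eq_mul] at this
    have := mul_right_cancel₀ hx this
    exact Nat.pow_right_injective le_rfl (by exact_mod_cast this)

end Hall

/-! ### The enveloping algebra -/

namespace UniversalEnvelopingAlgebra

attribute [local instance] LieRing.ofAssociativeRing

/-- The map `ι` corestricts to the generated subalgebra `A`, and so extends to U(L) → A. Followed by
the inclusion of `A` it fixes the generators, so it is the identity by the universal property and
`A` is everything. -/
theorem adjoin_range_ι (R L : Type*) [CommRing R] [LieRing L] [LieAlgebra R L] :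
    Algebra.adjoin R (Set.range (ι R : L →ₗ⁅R⁆ UniversalEnvelopingAlgebra R L)) = ⊤ := by
  set A := Algebra.adjoin R (Set.range (ι R : L →ₗ⁅R⁆ UniversalEnvelopingAlgebra R L)) with hA
  have hmem : ∀ x : L, ι R x ∈ A := fun x => Algebra.subset_adjoin ⟨x, rfl⟩
  let κ : L →ₗ⁅R⁆ A :=
    { (ι R : L →ₗ⁅R⁆ UniversalEnvelopingAlgebra R L).toLinearMap.codRestrict
        (Subalgebra.toSubmodule A) hmem with
      map_lie' := fun {x y} => Subtype.ext ((ι R).map_lie x y) }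
  have h : A.val.comp (lift R κ) = AlgHom.id R _ := by
    refine algHom_ext fun x => ?_
    rw [AlgHom.comp_apply, lift_ι_apply]
    rfl
  rw [eq_top_iff]
  intro u _
  have := DFunLike.congr_fun h u
  rw [AlgHom.comp_apply, AlgHom.id_apply] at this
  exact this ▸ (lift R κ u).2

end UniversalEnvelopingAlgebra

namespace Hall

open LabeledForest

attribute [local instance] LieRing.ofAssociativeRing

/-- The enveloping algebra of the Lie algebra on rooted trees. -/
abbrev Env : Type := UniversalEnvelopingAlgebra ℚ TreeLie

/-- The inclusion of `𝔫_T` as a Lie algebra homomorphism. -/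
noncomputable def inclLie : TreeLie →ₗ⁅ℚ⁆ Hall :=
  { incl with map_lie' := fun {x y} => incl_bracket x y }

/-- The extension of the inclusion to the enveloping algebra. -/
noncomputable def envHom : Env →ₐ[ℚ] Hall := UniversalEnvelopingAlgebra.lift ℚ inclLie

theorem envHom_ι (x : TreeLie) : envHom (UniversalEnvelopingAlgebra.ι ℚ x) = incl x :=
  UniversalEnvelopingAlgebra.lift_ι_apply ℚ inclLie x

open scoped Classical in
/-- The element of `𝔫_T` given by the class of a tree, and `0` for other classes. -/
noncomputable def treeElt (x : IsoClass) : TreeLie :=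
  if h : x.IsTree then TreeLie.ofTree ⟨x, h⟩ else 0

theorem incl_treeElt {x : IsoClass} (h : x.IsTree) : incl (treeElt x) = basis x :=
  (congrArg incl (dif_pos h)).trans (incl_ofTree ⟨x, h⟩)

theorem span_treeElt : Submodule.span ℚ (Set.range treeElt) = ⊤ := by
  rw [eq_top_iff, ← treeBasis.span_eq]
  refine Submodule.span_mono ?_
  rintro _ ⟨t, rfl⟩
  exact ⟨t.1, dif_pos t.2⟩

/-! ### Words in trees span the enveloping algebra -/

/-- The product in the enveloping algebra of a list of trees. -/
noncomputable def word (l : List IsoClass) : Env :=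
  (l.map fun x => UniversalEnvelopingAlgebra.ι ℚ (treeElt x)).prod

theorem word_cons (x : IsoClass) (l : List IsoClass) :
    word (x :: l) = UniversalEnvelopingAlgebra.ι ℚ (treeElt x) * word l := by
  simp [word]

/-- The span of the words of length less than `n`. -/
noncomputable def wordsBelow (n : ℕ) : Submodule ℚ Env :=
  Submodule.span ℚ {u | ∃ l : List IsoClass, l.length < n ∧ word l = u}

theorem ι_mul_mem_span {S T : Set Env} (h : ∀ x, ∀ u ∈ S,
    UniversalEnvelopingAlgebra.ι ℚ (treeElt x) * u ∈ T) (z : TreeLie) {u : Env}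
    (hu : u ∈ Submodule.span ℚ S) :
    UniversalEnvelopingAlgebra.ι ℚ z * u ∈ Submodule.span ℚ T := by
  induction hu using Submodule.span_induction with
  | mem u hu =>
    have hz : z ∈ Submodule.span ℚ (Set.range treeElt) := by rw [span_treeElt]; trivial
    induction hz using Submodule.span_induction with
    | mem z hz =>
      obtain ⟨x, rfl⟩ := hz
      exact Submodule.subset_span (h x u hu)
    | zero => rw [map_zero, zero_mul]; exact Submodule.zero_mem _
    | add z z' _ _ hz hz' => rw [map_add, add_mul]; exact Submodule.add_mem _ hz hz'
    | smul c z _ hz =>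
      rw [map_smul, smul_mul_assoc]; exact Submodule.smul_mem _ _ hz
  | zero => rw [mul_zero]; exact Submodule.zero_mem _
  | add u u' _ _ hu hu' => rw [mul_add]; exact Submodule.add_mem _ hu hu'
  | smul c u _ hu => rw [mul_smul_comm]; exact Submodule.smul_mem _ _ hu

theorem ι_mul_mem_wordsBelow (z : TreeLie) {n : ℕ} {u : Env} (hu : u ∈ wordsBelow n) :
    UniversalEnvelopingAlgebra.ι ℚ z * u ∈ wordsBelow (n + 1) := by
  refine ι_mul_mem_span (fun x u hu => ?_) z hu
  obtain ⟨l, hl, rfl⟩ := hu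
  exact ⟨x :: l, by simpa using hl, word_cons x l⟩

/-- Words that differ by a permutation agree up to shorter words. -/
theorem word_sub_word_mem {l l' : List IsoClass} (h : l.Perm l') :
    word l - word l' ∈ wordsBelow l.length := by
  induction h with
  | nil => rw [sub_self]; exact Submodule.zero_mem _
  | cons x _ ih =>
    rw [word_cons, word_cons, ← mul_sub]
    exact ι_mul_mem_wordsBelow _ ih
  | swap x y l =>
    -- The commutator of two adjacent letters is the image of their bracket, a single element of
    -- 𝔫_T, so the difference is a combination of words with one letter fewer.
    have : word (y :: x :: l) - word (x :: y :: l) =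
        UniversalEnvelopingAlgebra.ι ℚ ⁅treeElt y, treeElt x⁆ * word l := by
      rw [word_cons, word_cons, word_cons, word_cons, LieHom.map_lie,
        LieRing.of_associative_ring_bracket, sub_mul, mul_assoc, mul_assoc]
    rw [this]
    exact ι_mul_mem_wordsBelow _ (Submodule.subset_span ⟨l, by simp, rfl⟩)
  | trans h₁ _ ih₁ ih₂ =>
    rw [← h₁.length_eq] at ih₂
    have := Submodule.add_mem _ ih₁ ih₂
    rwa [sub_add_sub_cancel] at this

theorem span_word : Submodule.span ℚ (Set.range word) = ⊤ := by
  rw [eq_top_iff]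
  rintro u -
  have hu : u ∈ Algebra.adjoin ℚ
      (Set.range (UniversalEnvelopingAlgebra.ι ℚ : TreeLie →ₗ⁅ℚ⁆ Env)) := by
    rw [UniversalEnvelopingAlgebra.adjoin_range_ι]
    trivial
  have key : ∀ v ∈ Submodule.span ℚ (Set.range word),
      u * v ∈ Submodule.span ℚ (Set.range word) := by
    induction hu using Algebra.adjoin_induction with
    | mem u hu =>
      obtain ⟨z, rfl⟩ := hu
      refine fun v hv => ι_mul_mem_span (fun x u hu => ?_) z hv
      obtain ⟨l, rfl⟩ := hu
      exact ⟨x :: l, word_cons x l⟩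
    | algebraMap c =>
      intro v hv
      rw [← Algebra.smul_def]
      exact Submodule.smul_mem _ _ hv
    | add a b _ _ ha hb =>
      intro v hv
      rw [add_mul]
      exact Submodule.add_mem _ (ha v hv) (hb v hv)
    | mul a b _ _ ha hb =>
      intro v hv
      rw [mul_assoc]
      exact ha _ (hb v hv)
  have := key 1 (Submodule.subset_span ⟨[], by simp [word]⟩)
  rwa [mul_one] at this

/-- The linear map that sends the characteristic function of a forest to the product of its
components. -/
noncomputable def ordered : Hall →ₗ[ℚ] Env := basis.constr ℚ fun x => word x.comps.toList

theorem ordered_basis (x : IsoClass) : ordered (basis x) = word x.comps.toList :=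
  basis.constr_basis _ _ _

/-- Sorting: a word in trees agrees, modulo shorter words, with the word of its letters in the order
that `toList` picks for that multiset, and the shorter words are in the range by induction. A word
with a letter that is not a tree is zero. -/
theorem wordsBelow_le_range (n : ℕ) : wordsBelow n ≤ LinearMap.range ordered := by
  induction n with
  | zero =>
    refine Submodule.span_le.2 ?_
    rintro _ ⟨l, hl, rfl⟩
    simp at hl
  | succ n ih =>
    refine Submodule.span_le.2 ?_
    rintro _ ⟨l, hl, rfl⟩
    by_cases hl' : ∀ x ∈ l, x.IsTree
    · have hperm : l.Perm (l.sum.comps.toList) := by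
        rw [← Multiset.coe_eq_coe, Multiset.coe_toList, ← Multiset.sum_coe, comps_sum hl']
      have h1 := word_sub_word_mem hperm
      have h2 : wordsBelow l.length ≤ wordsBelow n := Submodule.span_mono fun u => by
        rintro ⟨l', h, rfl⟩
        exact ⟨l', by omega, rfl⟩
      have h3 := Submodule.add_mem _ (ih (h2 h1)) ⟨basis l.sum, ordered_basis _⟩
      rwa [sub_add_cancel] at h3
    · push Not at hl'
      obtain ⟨x, hx, hx'⟩ := hl'
      have : word l = 0 := by
        refine List.prod_eq_zero (List.mem_map.2 ⟨x, hx, ?_⟩)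
        rw [treeElt, dif_neg hx', map_zero]
      rw [this]
      exact Submodule.zero_mem _

theorem ordered_surjective : Function.Surjective ordered := by
  rw [← LinearMap.range_eq_top, eq_top_iff, ← span_word, Submodule.span_le]
  rintro _ ⟨l, rfl⟩
  exact wordsBelow_le_range _ (Submodule.subset_span ⟨l, Nat.lt_succ_self _, rfl⟩)

theorem envHom_word {l : List IsoClass} (hl : ∀ x ∈ l, x.IsTree) :
    envHom (word l) = (l.map basis).prod := by
  rw [word, map_list_prod, List.map_map]
  congr 1
  refine List.map_congr_left fun x hx => ?_
  rw [Function.comp_apply, envHom_ι, incl_treeElt (hl x hx)]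

/-! ### Triangularity with respect to the number of components -/

open scoped Classical in
theorem ev_basis_mul (x : IsoClass) (g : Hall) (F : LabeledForest) :
    ev F.cls (basis x * g) =
      ∑ S ∈ F.subforests, if x = (F.restrict S).cls then ev (F.quot S).cls g else 0 := by
  rw [ev_mul]
  refine Finset.sum_congr rfl fun S _ => ?_
  rw [ev_basis, ite_mul, one_mul, zero_mul]

/-- The structure constants of the product count subforests. Nonnegativity excludes cancellation
when the leading coefficient is shown to be positive. -/
theorem ev_prod_nonneg (l : List IsoClass) (x : IsoClass) : 0 ≤ ev x (l.map basis).prod := by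
  classical
  induction l generalizing x with
  | nil =>
    rw [List.map_nil, List.prod_nil, ev_one]
    split_ifs <;> norm_num
  | cons a l ih =>
    obtain ⟨F, rfl⟩ := exists_cls x
    rw [List.map_cons, List.prod_cons, ev_basis_mul]
    refine Finset.sum_nonneg fun S _ => ?_
    split_ifs
    exacts [ih _, le_rfl]

/-- In the disjoint union of the first forest with the rest, cutting off exactly the first summand
contributes a positive term by induction, and all other terms are nonnegative. -/
theorem ev_prod_sum_pos (l : List IsoClass) : 0 < ev l.sum (l.map basis).prod := by
  classical
  induction l with
  | nil => rw [List.map_nil, List.prod_nil, List.sum_nil, ev_one, if_pos rfl]; exact one_pos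
  | cons a l ih =>
    obtain ⟨F, rfl⟩ := exists_cls a
    obtain ⟨G, hG⟩ := exists_cls l.sum
    rw [← hG] at ih
    rw [List.map_cons, List.prod_cons, List.sum_cons, ← hG, ← cls_oplus, ev_basis_mul]
    have hmem : sumLab F.lab ∅ ∈ (F.oplus G).subforests :=
      sumLab_mem_subforests.2 ⟨lab_mem_subforests F, empty_mem_subforests G⟩
    refine Finset.sum_pos' (fun S _ => ?_) ⟨_, hmem, ?_⟩
    · split_ifs
      exacts [ev_prod_nonneg _ _, le_rfl]
    · have h1 : ((F.oplus G).restrict (sumLab F.lab ∅)).cls = F.cls := by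
        rw [oplus_restrict, restrict_self, restrict_empty, cls_oplus_empty]
      have h2 : ((F.oplus G).quot (sumLab F.lab ∅)).cls = G.cls := by
        rw [oplus_quot, quot_empty, quot, Finset.sdiff_self, restrict_empty, cls_empty_oplus]
      rwa [h1, if_pos rfl, h2]

/-- The product of `k` trees is supported on their disjoint union and on forests with fewer than
`k` components. -/
theorem eq_sum_of_ev_prod_ne_zero {l : List IsoClass} (hl : ∀ x ∈ l, x.IsTree) {x : IsoClass}
    (hx : ev x (l.map basis).prod ≠ 0) : x.comps.card < l.length ∨ x = l.sum := by
  classical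
  induction l generalizing x with
  | nil =>
    rw [List.map_nil, List.prod_nil, ev_one] at hx
    exact Or.inr (by_contra fun h => hx (if_neg h))
  | cons a l ih =>
    obtain ⟨F, rfl⟩ := exists_cls x
    rw [List.map_cons, List.prod_cons, ev_basis_mul] at hx
    obtain ⟨S, hS, h⟩ := Finset.exists_ne_zero_of_sum_ne_zero hx
    rw [ne_eq, ite_eq_right_iff, Classical.not_imp] at h
    obtain ⟨h1, h2⟩ := h
    have ha := isTree_iff_card_comps.1 (hl a List.mem_cons_self)
    rw [h1, card_comps_cls] at ha
    have hle := card_roots_le hS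
    have hsum : (F.quot S).cls.comps.card ≤ l.length := by
      rcases ih (fun x hx => hl x (List.mem_cons_of_mem _ hx)) h2 with h | h
      · exact h.le
      · rw [h, ← Multiset.sum_coe, comps_sum fun x hx => hl x (List.mem_cons_of_mem _ hx),
          Multiset.coe_card]
    rw [card_comps_cls] at hsum
    rw [card_comps_cls, List.length_cons]
    by_cases hF : F.roots.card < l.length + 1
    · exact Or.inl hF
    -- Now `F` has at least `l.length + 1` roots. The subforest has one root and the quotient at
    -- most `l.length`, so `card_roots_le` is an equality: the quotient cannot have fewer
    -- components, and the subforest splits off as a summand.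
    · right
      have hq : (F.quot S).cls = l.sum := by
        rcases ih (fun x hx => hl x (List.mem_cons_of_mem _ hx)) h2 with h | h
        · rw [card_comps_cls] at h
          omega
        · exact h
      rw [← cls_eq_oplus_of_card_roots hS (by omega), cls_oplus, hq, ← h1, List.sum_cons]

/-- The composition of `ordered` with the homomorphism from the enveloping algebra. -/
noncomputable def triangular : Hall →ₗ[ℚ] Hall := envHom.toLinearMap ∘ₗ ordered

theorem triangular_basis (x : IsoClass) :
    triangular (basis x) = (x.comps.toList.map basis).prod := by
  rw [triangular, LinearMap.comp_apply, ordered_basis, AlgHom.toLinearMap_apply, envHom_word]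
  intro y hy
  exact isTree_of_mem_comps (Multiset.mem_toList.1 hy)

theorem sum_toList_comps (x : IsoClass) : x.comps.toList.sum = x := by
  rw [Multiset.sum_toList, sum_comps]

theorem ev_triangular_self (x : IsoClass) : ev x (triangular (basis x)) ≠ 0 := by
  rw [triangular_basis]
  have := ev_prod_sum_pos x.comps.toList
  rw [sum_toList_comps] at this
  exact this.ne'

theorem ev_triangular_ne_zero {x y : IsoClass} (h : ev x (triangular (basis y)) ≠ 0) :
    x.comps.card < y.comps.card ∨ x = y := by
  rw [triangular_basis] at h
  have := eq_sum_of_ev_prod_ne_zero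
    (fun z hz => isTree_of_mem_comps (Multiset.mem_toList.1 hz)) h
  rwa [Multiset.length_toList, sum_toList_comps] at this

/-- Induction on the number of components: apart from its term at `x`, the image of `basis x`
involves only classes with fewer components, which are already in the range. Dividing by the nonzero
diagonal coefficient gives `basis x`. -/
theorem triangular_surjective : Function.Surjective triangular := by
  rw [← LinearMap.range_eq_top, eq_top_iff, ← basis.span_eq, Submodule.span_le]
  rintro _ ⟨x, rfl⟩
  induction hn : x.comps.card using Nat.strong_induction_on generalizing x with
  | _ n ih =>
    subst hn
    have h1 : triangular (basis x) - ev x (triangular (basis x)) • basis x ∈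
        Submodule.span ℚ (basis '' {y | y.comps.card < x.comps.card}) := by
      classical
      rw [mem_span_basis_iff]
      intro y hy
      rw [map_sub, map_smul, ev_basis, smul_eq_mul] at hy
      by_cases hxy : x = y
      · subst hxy
        simp at hy
      · rw [if_neg hxy, mul_zero, sub_zero] at hy
        exact (ev_triangular_ne_zero hy).resolve_right fun h => hxy h.symm
    have h2 : Submodule.span ℚ (basis '' {y | y.comps.card < x.comps.card}) ≤
        LinearMap.range triangular := by
      rw [Submodule.span_le]
      rintro _ ⟨y, hy, rfl⟩
      exact ih _ hy y rfl
    have h3 := Submodule.sub_mem _ (LinearMap.mem_range_self triangular (basis x)) (h2 h1)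
    rw [sub_sub_cancel] at h3
    exact (Submodule.smul_mem_iff _ (ev_triangular_self x)).1 h3

/-- Choose `x` in the support of `f` with the most components. No other class in the support
contributes to the coefficient of the image at `x`, and the contribution of `x` itself is nonzero.
-/
theorem triangular_injective : Function.Injective triangular := by
  rw [← LinearMap.ker_eq_bot, LinearMap.ker_eq_bot']
  intro f hf
  by_contra hne
  have hsupp : (basis.repr f).support.Nonempty := by
    rw [Finsupp.support_nonempty_iff]
    simpa using hne
  obtain ⟨x, hx, hmax⟩ := Finset.exists_max_image _ (fun x : IsoClass => x.comps.card) hsupp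
  have h := congrArg (ev x ∘ₗ triangular) (basis.linearCombination_repr f)
  rw [LinearMap.comp_apply, LinearMap.comp_apply, hf, map_zero, Finsupp.linearCombination_apply,
    Finsupp.sum, map_sum, map_sum, Finset.sum_eq_single_of_mem x hx] at h
  · rw [map_smul, map_smul, smul_eq_mul, mul_eq_zero] at h
    exact h.elim (Finsupp.mem_support_iff.1 hx) (ev_triangular_self x)
  · intro y hy hyx
    rw [map_smul, map_smul, smul_eq_mul, mul_eq_zero]
    right
    by_contra h'
    rcases ev_triangular_ne_zero h' with h' | h'
    · exact absurd (hmax y hy) (not_le.2 h')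
    · exact hyx h'.symm

/-- `triangular` is `envHom` after `ordered`. Surjectivity passes from the composite to `envHom`;
injectivity does too, because every element of the enveloping algebra is a value of `ordered`. -/
theorem envHom_bijective : Function.Bijective envHom := by
  constructor
  · rw [injective_iff_map_eq_zero]
    intro u hu
    obtain ⟨f, rfl⟩ := ordered_surjective u
    have : f = 0 := triangular_injective ((show triangular f = 0 from hu).trans (map_zero _).symm)
    rw [this, map_zero]
  · intro f
    obtain ⟨g, rfl⟩ := triangular_surjective f
    exact ⟨ordered g, rfl⟩

theorem counit_incl (x : TreeLie) : Coalgebra.counit (R := ℚ) (incl x) = 0 := by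
  rw [counit_eq]
  by_contra h
  exact IsTree.ne_zero (mem_span_basis_iff.1 (isPrim_iff.1 (isPrim_incl x)) 0 h) rfl

/-- The homomorphism from the enveloping algebra is compatible with the coproducts. -/
noncomputable def envBialgHom : Env →ₐc[ℚ] Hall :=
  .ofAlgHom envHom
    (UniversalEnvelopingAlgebra.algHom_ext fun x => by
      have h : Coalgebra.counit (R := ℚ) (UniversalEnvelopingAlgebra.ι ℚ x : Env) = 0 :=
        UniversalEnvelopingAlgebra.lift_ι_apply ℚ (0 : TreeLie →ₗ⁅ℚ⁆ ℚ) x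
      rw [AlgHom.comp_apply, envHom_ι, Bialgebra.counitAlgHom_apply, Bialgebra.counitAlgHom_apply,
        h, counit_incl])
    (UniversalEnvelopingAlgebra.algHom_ext fun x => by
      have h : Coalgebra.comul (R := ℚ) (UniversalEnvelopingAlgebra.ι ℚ x : Env) =
          UniversalEnvelopingAlgebra.ι ℚ x ⊗ₜ[ℚ] 1 + 1 ⊗ₜ[ℚ] UniversalEnvelopingAlgebra.ι ℚ x :=
        UniversalEnvelopingAlgebra.lift_ι_apply ℚ
          (UniversalEnvelopingAlgebra.primitiveHom ℚ TreeLie) x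
      rw [AlgHom.comp_apply, AlgHom.comp_apply, envHom_ι, Bialgebra.comulAlgHom_apply,
        Bialgebra.comulAlgHom_apply, h, map_add, Algebra.TensorProduct.map_tmul,
        Algebra.TensorProduct.map_tmul, envHom_ι, map_one]
      exact (isPrim_incl x).symm)

/-- The isomorphism from the enveloping algebra. -/
noncomputable def envEquiv : Env ≃ₐc[ℚ] Hall := .ofBijective envBialgHom envHom_bijective

theorem envEquiv_ι (x : TreeLie) : envEquiv (UniversalEnvelopingAlgebra.ι ℚ x) = incl x :=
  envHom_ι x

/-! ### The antipode -/

/-- The isomorphism with the enveloping algebra shows that the Hall algebra is generated by its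
primitive elements, where the antipode is -1. The antipode identities and the compatibility with
`scale` are proved by this induction. -/
theorem induction_incl {p : Hall → Prop} (h₀ : ∀ c : ℚ, p (algebraMap ℚ Hall c))
    (h₁ : ∀ x, p (incl x)) (hadd : ∀ f g, p f → p g → p (f + g))
    (hmul : ∀ f g, p f → p g → p (f * g)) (f : Hall) : p f := by
  obtain ⟨u, rfl⟩ := envHom_bijective.2 f
  have hu : u ∈ Algebra.adjoin ℚ
      (Set.range (UniversalEnvelopingAlgebra.ι ℚ : TreeLie →ₗ⁅ℚ⁆ Env)) := by
    rw [UniversalEnvelopingAlgebra.adjoin_range_ι]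
    trivial
  induction hu using Algebra.adjoin_induction with
  | mem u hu =>
    obtain ⟨z, rfl⟩ := hu
    rw [envHom_ι]
    exact h₁ z
  | algebraMap c => rw [AlgHom.commutes]; exact h₀ c
  | add a b _ _ ha hb => rw [map_add]; exact hadd _ _ ha hb
  | mul a b _ _ ha hb => rw [map_mul]; exact hmul _ _ ha hb

/-- The Lie algebra homomorphism `x ↦ -x` into the opposite algebra. -/
noncomputable def negOp : TreeLie →ₗ⁅ℚ⁆ Hallᵐᵒᵖ :=
  { -((MulOpposite.opLinearEquiv ℚ).toLinearMap ∘ₗ incl) with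
    map_lie' := fun {x y} => by
      change -MulOpposite.op (incl ⁅x, y⁆) =
        ⁅-MulOpposite.op (incl x), -MulOpposite.op (incl y)⁆
      rw [incl_bracket, LieRing.of_associative_ring_bracket, neg_mul_neg, neg_mul_neg,
        ← MulOpposite.op_mul, ← MulOpposite.op_mul, ← MulOpposite.op_sub, ← MulOpposite.op_neg,
        neg_sub] }

/-- The antipode, as a homomorphism to the opposite algebra. -/
noncomputable def antipodeOp : Hall →ₐ[ℚ] Hallᵐᵒᵖ :=
  (UniversalEnvelopingAlgebra.lift ℚ negOp).comp
    (AlgEquiv.ofBijective envHom envHom_bijective).symm.toAlgHom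

theorem antipodeOp_incl (x : TreeLie) : antipodeOp (incl x) = MulOpposite.op (-incl x) := by
  have : (AlgEquiv.ofBijective envHom envHom_bijective).symm (incl x) =
      UniversalEnvelopingAlgebra.ι ℚ x := by
    rw [AlgEquiv.symm_apply_eq]
    exact (envHom_ι x).symm
  change UniversalEnvelopingAlgebra.lift ℚ negOp
    ((AlgEquiv.ofBijective envHom envHom_bijective).symm (incl x)) = _
  rw [this, UniversalEnvelopingAlgebra.lift_ι_apply]
  rfl

/-- The antipode. -/
noncomputable def antipodeHall : Hall →ₗ[ℚ] Hall :=
  (MulOpposite.opLinearEquiv ℚ).symm.toLinearMap ∘ₗ antipodeOp.toLinearMap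

theorem antipodeHall_apply (f : Hall) : antipodeHall f = (antipodeOp f).unop := rfl

theorem antipodeHall_incl (x : TreeLie) : antipodeHall (incl x) = -incl x := by
  rw [antipodeHall_apply, antipodeOp_incl, MulOpposite.unop_op]

theorem antipodeHall_mul (f g : Hall) :
    antipodeHall (f * g) = antipodeHall g * antipodeHall f := by
  simp only [antipodeHall_apply, map_mul, MulOpposite.unop_mul]

theorem antipodeHall_algebraMap (c : ℚ) :
    antipodeHall (algebraMap ℚ Hall c) = algebraMap ℚ Hall c := by
  rw [antipodeHall_apply, AlgHom.commutes]
  rfl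

theorem antipodeHall_one : antipodeHall 1 = 1 := by
  simpa using antipodeHall_algebraMap 1

theorem mul_antipode_rTensor (f : Hall) :
    LinearMap.mul' ℚ Hall (antipodeHall.rTensor Hall (Coalgebra.comul (R := ℚ) f)) =
      algebraMap ℚ Hall (Coalgebra.counit (R := ℚ) f) := by
  induction f using induction_incl with
  | h₀ c =>
    rw [Bialgebra.comul_algebraMap, Bialgebra.counit_algebraMap,
      Algebra.TensorProduct.algebraMap_apply, LinearMap.rTensor_tmul, LinearMap.mul'_apply,
      antipodeHall_algebraMap, mul_one]
  | h₁ x =>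
    rw [isPrim_incl x, map_add, map_add, LinearMap.rTensor_tmul, LinearMap.rTensor_tmul,
      LinearMap.mul'_apply, LinearMap.mul'_apply, antipodeHall_incl, antipodeHall_one, one_mul,
      mul_one, counit_incl, map_zero, neg_add_cancel]
  | hadd f g hf hg => simp only [map_add, hf, hg]
  | hmul f g hf hg =>
    -- Since the antipode reverses products, right multiplication by c ⊗ d places S(c) and d around
    -- the value at t. For t = Δ(f) that inner value is the scalar ε(f), which can be pulled out,
    -- leaving the identity for `g`.
    have key : ∀ (t : Hall ⊗[ℚ] Hall) (c d : Hall),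
        LinearMap.mul' ℚ Hall (antipodeHall.rTensor Hall (t * c ⊗ₜ[ℚ] d)) =
          antipodeHall c * LinearMap.mul' ℚ Hall (antipodeHall.rTensor Hall t) * d := by
      intro t c d
      induction t with
      | zero => simp
      | add t u ht hu => simp only [map_add, add_mul, mul_add, ht, hu]
      | tmul a b => simp [antipodeHall_mul, mul_assoc]
    have key' : ∀ u : Hall ⊗[ℚ] Hall,
        LinearMap.mul' ℚ Hall (antipodeHall.rTensor Hall (Coalgebra.comul (R := ℚ) f * u)) =
          Coalgebra.counit (R := ℚ) f •
            LinearMap.mul' ℚ Hall (antipodeHall.rTensor Hall u) := by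
      intro u
      induction u with
      | zero => simp
      | add t u ht hu => simp only [map_add, mul_add, ht, hu, smul_add]
      | tmul c d =>
        rw [key, hf, Algebra.algebraMap_eq_smul_one, mul_smul_comm, mul_one, smul_mul_assoc]
        rfl
    rw [comul_mul, key', hg, counit_mul, map_mul, Algebra.smul_def]

theorem mul_antipode_lTensor (f : Hall) :
    LinearMap.mul' ℚ Hall (antipodeHall.lTensor Hall (Coalgebra.comul (R := ℚ) f)) =
      algebraMap ℚ Hall (Coalgebra.counit (R := ℚ) f) := by
  induction f using induction_incl with
  | h₀ c =>
    rw [Bialgebra.comul_algebraMap, Bialgebra.counit_algebraMap,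
      Algebra.TensorProduct.algebraMap_apply, LinearMap.lTensor_tmul, LinearMap.mul'_apply,
      antipodeHall_one, mul_one]
  | h₁ x =>
    rw [isPrim_incl x, map_add, map_add, LinearMap.lTensor_tmul, LinearMap.lTensor_tmul,
      LinearMap.mul'_apply, LinearMap.mul'_apply, antipodeHall_incl, antipodeHall_one, one_mul,
      mul_one, counit_incl, map_zero, add_neg_cancel]
  | hadd f g hf hg => simp only [map_add, hf, hg]
  | hmul f g hf hg =>
    -- The mirror image: here the tensor multiplies on the left, and the coproduct of `g` collapses
    -- first.
    have key : ∀ (t : Hall ⊗[ℚ] Hall) (a b : Hall),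
        LinearMap.mul' ℚ Hall (antipodeHall.lTensor Hall (a ⊗ₜ[ℚ] b * t)) =
          a * LinearMap.mul' ℚ Hall (antipodeHall.lTensor Hall t) * antipodeHall b := by
      intro t a b
      induction t with
      | zero => simp
      | add t u ht hu => simp only [map_add, add_mul, mul_add, ht, hu]
      | tmul c d => simp [antipodeHall_mul, mul_assoc]
    have key' : ∀ t : Hall ⊗[ℚ] Hall,
        LinearMap.mul' ℚ Hall (antipodeHall.lTensor Hall (t * Coalgebra.comul (R := ℚ) g)) =
          Coalgebra.counit (R := ℚ) g •
            LinearMap.mul' ℚ Hall (antipodeHall.lTensor Hall t) := by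
      intro t
      induction t with
      | zero => simp
      | add t u ht hu => simp only [map_add, add_mul, ht, hu, smul_add]
      | tmul a b =>
        rw [key, hg, Algebra.algebraMap_eq_smul_one, mul_smul_comm, mul_one, smul_mul_assoc]
        rfl
    rw [comul_mul, key', hf, counit_mul, map_mul, Algebra.smul_def, Algebra.commutes]

noncomputable scoped instance instHopfAlgebra : HopfAlgebra ℚ Hall where
  antipode := antipodeHall
  mul_antipode_rTensor_comul := LinearMap.ext mul_antipode_rTensor
  mul_antipode_lTensor_comul := LinearMap.ext mul_antipode_lTensor

/-- Both sides are anti-multiplicative in `f`, so primitives suffice. There the antipode is -1, and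
`scale` keeps an element primitive because it does not enlarge the support. -/
theorem antipodeHall_scale (f : Hall) : antipodeHall (scale f) = scale (antipodeHall f) := by
  induction f using induction_incl with
  | h₀ c => rw [AlgHom.commutes, antipodeHall_algebraMap, AlgHom.commutes]
  | h₁ x =>
    have : scale (incl x) ∈ LinearMap.range incl := by
      rw [mem_range_incl, isPrim_iff, mem_span_basis_iff]
      intro y hy
      rw [ev_scale] at hy
      exact mem_span_basis_iff.1 (isPrim_iff.1 (isPrim_incl x)) y (right_ne_zero_of_mul hy)
    obtain ⟨z, hz⟩ := this
    rw [antipodeHall_incl, ← hz, antipodeHall_incl, map_neg, hz]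
  | hadd f g hf hg => simp only [map_add, hf, hg]
  | hmul f g hf hg => rw [map_mul, antipodeHall_mul, hf, hg, antipodeHall_mul, map_mul]

theorem antipode_mem_homog {n : ℕ} {f : Hall} (hf : f ∈ homog n) :
    antipodeHall f ∈ homog n := by
  rw [mem_homog_iff_scale] at *
  rw [← antipodeHall_scale, hf, map_smul]

/-! ### Assembling the theorem -/

theorem degree_eq_homog : degree = homog := by
  funext n
  rw [degree, homog]
  congr 1
  ext f
  constructor
  · rintro ⟨F, hF, rfl⟩
    exact ⟨F.cls, (size_cls F).trans hF, rfl⟩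
  · rintro ⟨x, hx, rfl⟩
    obtain ⟨F, rfl⟩ := exists_cls x
    exact ⟨F, (size_cls F).symm.trans hx, rfl⟩

theorem isGradedConnected : IsGradedConnected where
  graded := by
    rw [degree_eq_homog]
    exact ⟨instGradedAlgebra⟩
  comul_mem n f hf := by
    rw [degree_eq_homog] at *
    exact comul_mem_homog hf
  counit_eq_zero n hn f hf := by
    rw [degree_eq_homog, mem_homog_iff] at hf
    rw [counit_eq]
    by_contra h
    exact hn ((hf 0 h).symm.trans (size_eq_zero.2 rfl))
  antipode_mem n f hf := by
    rw [degree_eq_homog] at *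
    exact antipode_mem_homog hf
  connected := by rw [degree_eq_homog, homog_zero]

theorem isRingelHall : IsRingelHall where
  val_mul := ev_mul
  val_comul := ⟨fun F => ev F.cls, fun F f => ev_eq_val f F, fun f F G => mul'_map_ev F G f⟩

theorem setOf_isPrim_eq :
    {f : Hall | IsPrim f} =
      Submodule.span ℚ {f : Hall | ∃ T : LabeledForest, T.IsTree ∧ f = Hall.delta T.cls} := by
  ext f
  have : {f : Hall | ∃ T : LabeledForest, T.IsTree ∧ f = Hall.delta T.cls} =
      basis '' {x | x.IsTree} := by
    ext g
    constructor
    · rintro ⟨T, hT, rfl⟩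
      exact ⟨T.cls, ⟨T, hT, rfl⟩, rfl⟩
    · rintro ⟨_, ⟨T, hT, rfl⟩, rfl⟩
      exact ⟨T, hT, rfl⟩
  rw [this]
  exact isPrim_iff

end Hall

theorem mainTheorem1 :
    ∃ (_ : LieRing TreeLie) (_ : LieAlgebra ℚ TreeLie) (_ : Ring Hall) (_ : HopfAlgebra ℚ Hall),
      TreeLie.IsConnesKreimer ∧
      Hall.IsRingelHall ∧
      Coalgebra.IsCocomm ℚ Hall ∧
      Hall.IsGradedConnected ∧
      {f : Hall | Coalgebra.comul (R := ℚ) f = f ⊗ₜ[ℚ] 1 + 1 ⊗ₜ[ℚ] f} =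
        Submodule.span ℚ {f : Hall | ∃ T : LabeledForest, T.IsTree ∧ f = Hall.delta T.cls} ∧
      (∀ t₁ t₂ : UnlabeledTree,
        Hall.delta t₁.1 * Hall.delta t₂.1 - Hall.delta t₂.1 * Hall.delta t₁.1 =
          Hall.ofTrees ⁅TreeLie.ofTree t₁, TreeLie.ofTree t₂⁆) ∧
      ∃ e : UniversalEnvelopingAlgebra ℚ TreeLie ≃ₐc[ℚ] Hall,
        ∀ x : TreeLie, e (UniversalEnvelopingAlgebra.ι ℚ x) = Hall.ofTrees x := by
  refine ⟨Hall.instLieRing, Hall.instLieAlgebra, Hall.instRing, Hall.instHopfAlgebra,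
    Hall.isConnesKreimer, Hall.isRingelHall, Hall.instIsCocomm, Hall.isGradedConnected,
    Hall.setOf_isPrim_eq, fun t₁ t₂ => ?_, Hall.envEquiv, Hall.envEquiv_ι⟩
  have := Hall.incl_bracket (TreeLie.ofTree t₁) (TreeLie.ofTree t₂)
  rw [Hall.incl_ofTree, Hall.incl_ofTree] at this
  exact this.symm
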